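/- Let $\mathbb T^3=(\mathbb R/2\pi\mathbb Z)^3$, let $\gamma\in(0,1/2)$, $N>0$, $\varepsilon_\kappa>0$, let $m\ge 1$ be an integer and let $S(x)=\varepsilon_\kappa m^{2\gamma}\sin(m x_3)$. Consider the fractionally diffusive magnetogeostrophic (MG) Cauchy problem $$\partial_t\theta+u\cdot\nabla\theta=-\varepsilon_\kappa(-\Delta)^{\gamma}\theta+S,\qquad u=M[\theta],\qquad \theta(0,\cdot)=\theta_0,$$ on $\mathbb T^3$, where $u_j=M_j[\theta]$ is the Fourier multiplier with symbol $\widehat M_j(k)=0$ if $k_3=0$ and, if $k_3\neq 0$, with $D(k)=N^4|k|^2k_3^2+k_2^4$, $$\widehat M_1=\frac{N^4k_2k_3|k|^2-N^2k_1k_2^2k_3}{D},\quad \widehat M_2=\frac{-N^4k_1k_3|k|^2-N^2k_2^3k_3}{D},\quad \widehat M_3=\frac{N^2k_1^2k_2^2+N^2k_2^4}{D}.$$ Here a Sobolev space is one of the spaces $W^{n,p}(\mathbb T^3)$ ($n\in\mathbb N$, $1\le p\le\infty$) or $H^{s,p}(\mathbb T^3)=\{f:(1-\Delta)^{s/2}f\in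 L^p\}$ ($s\ge 0$, $1<p<\infty$; $H^{s,2}=H^s$). For Sobolev spaces $Y\subset X\subset W^{1,4}(\mathbb T^3)$ (continuous embeddings), the problem is called locally Lipschitz $(X,Y)$ well-posed if there are continuous functions $T,K:[0,\infty)^2\to(0,\infty)$ such that for every pair of initial data $\theta^{(1)}_0,\theta^{(2)}_0\in Y$ with zero vertical mean ($\int\theta^{(i)}_0\,dx_3=0$) there exist unique solutions $\theta^{(1)},\theta^{(2)}\in L^\infty(0,T;X)$ (in the sense of distributions) with these data, and $$\|\theta^{(1)}(t,\cdot)-\theta^{(2)}(t,\cdot)\|_X\le K\,\|\theta^{(1)}_0-\theta^{(2)}_0\|_Y\qquad\text{for almost every }t\in[0,T],$$ where $T$ and $K$ are evaluated at $(\|\theta^{(1)}_0\|_Y,\|\theta^{(2)}_0\|_Y)$. It is called locally Lipschitz $(X,Y)$ ill-posed if it is not locally Lipschitz $(X,Y)$ well-posed. Then, for all Sobolev spaces $Y\subset X$ continuously embedded in $W^{1,4}(\mathbb T^3)$, the Cauchy problem above is locally Lipschitz $(X,Y)$ ill-posed. -/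

import Mathlib

open MeasureTheory
open scoped NNReal ENNReal

noncomputable section

namespace MG

/-- The torus `𝕋³ = (ℝ / 2πℤ)³`, parametrised by `y = x / (2π) ∈ (ℝ / ℤ)³`. The character `mFourier k` is `exp (2πi k·y) = exp (i k·x)`, so in the
variable `x` the derivative `∂_j` has symbol `i k_j`. All operators below act in the variable
`x`. -/
abbrev Torus : Type := UnitAddTorus (Fin 3)

/-- Normalised Lebesgue (Haar) measure on the torus. -/
abbrev torusMeasure : Measure Torus := Measure.pi fun _ => AddCircle.haarAddCircle

/-- Frequencies `k = (k₁, k₂, k₃) ∈ ℤ³` (indexed by `0, 1, 2`). -/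
abbrev Freq : Type := Fin 3 → ℤ

/-- Fourier coefficient `f̂(k)` of a real function on the torus. -/
def coeff (f : Torus → ℝ) (k : Freq) : ℂ :=
  UnitAddTorus.mFourierCoeff (fun y => (f y : ℂ)) k

/-- `|k|²`. -/
def normSq (k : Freq) : ℝ := ∑ j, (k j : ℝ) ^ 2

/-- `g` is the image of `f` under the Fourier multiplier with symbol `σ`, that is
`ĝ(k) = σ(k) f̂(k)` for all `k` (equality of distributions on the torus, tested on characters).
Both functions are required to be integrable; `g` is then unique up to null sets. -/
def IsMultiplier (σ : Freq → ℂ) (f g : Torus → ℝ) : Prop :=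
  Integrable f torusMeasure ∧ Integrable g torusMeasure ∧ ∀ k, coeff g k = σ k * coeff f k

/-- `‖σ(D) f‖_{L^p}`; it is `∞` if `σ(D) f` is not an integrable function. -/
def multiplierNorm (σ : Freq → ℂ) (p : ℝ≥0∞) (f : Torus → ℝ) : ℝ≥0∞ :=
  ⨅ (g : Torus → ℝ) (_ : IsMultiplier σ f g), eLpNorm g p torusMeasure

/-- Symbol `(ik)^α` of the weak derivative `∂^α`. -/
def derivSymbol (α : Fin 3 → ℕ) (k : Freq) : ℂ :=
  ∏ j, (Complex.I * (k j : ℂ)) ^ α j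

/-- Symbol `(1 + |k|²)^{s/2}` of `(1 - Δ)^{s/2}`. -/
def besselSymbol (s : ℝ) (k : Freq) : ℂ :=
  (((1 + normSq k) ^ (s / 2) : ℝ) : ℂ)

/-- Multi-indices `α` of order `|α| ≤ n`. -/
def multiIndices (n : ℕ) : Finset (Fin 3 → ℕ) :=
  (Fintype.piFinset fun _ => Finset.range (n + 1)).filter fun α => ∑ j, α j ≤ n

/-- Sobolev spaces on the torus: the spaces `W^{n,p}`, `n ∈ ℕ`, `1 ≤ p ≤ ∞`, of functions with weak
derivatives up to order `n` in `L^p`, and the spaces `H^{s,p}`, `s ≥ 0` real, `1 < p < ∞`, of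
functions with `(1 - Δ)^{s/2} f ∈ L^p` (so that `H^{s,2}` is `H^s`). -/
inductive SobolevSpace : Type
  | W (n : ℕ) (p : ℝ≥0∞) (hp : 1 ≤ p)
  | H (s : ℝ≥0) (p : ℝ≥0∞) (hp : 1 < p) (hp' : p < ∞)

/-- The norm of a Sobolev space; the space consists of the `f` whose norm is finite. -/
def SobolevSpace.norm : SobolevSpace → (Torus → ℝ) → ℝ≥0∞
  | .W n p _, f => ∑ α ∈ multiIndices n, multiplierNorm (derivSymbol α) p f
  | .H s p _ _, f => multiplierNorm (besselSymbol s) p f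

/-- Membership in a Sobolev space. -/
def SobolevSpace.Mem (X : SobolevSpace) (f : Torus → ℝ) : Prop := X.norm f < ∞

/-- Continuous embedding `Y ⊂ X`. -/
def SobolevSpace.Embeds (Y X : SobolevSpace) : Prop :=
  ∃ C : ℝ≥0, ∀ f, X.norm f ≤ C * Y.norm f

/-- The space `W^{1,4}(𝕋³)`. -/
def W14 : SobolevSpace := .W 1 4 (by norm_num)

/-- `D(k) = N⁴ |k|² k₃² + k₂⁴`. -/
def symbolD (N : ℝ) (k : Freq) : ℝ :=
  N ^ 4 * normSq k * (k 2 : ℝ) ^ 2 + (k 1 : ℝ) ^ 4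

/-- Numerators of the symbols of `M₁`, `M₂`, `M₃`. -/
def velocityNumerator (N : ℝ) (k : Freq) : Fin 3 → ℝ :=
  ![N ^ 4 * k 1 * k 2 * normSq k - N ^ 2 * k 0 * (k 1 : ℝ) ^ 2 * k 2,
    -(N ^ 4 * k 0 * k 2 * normSq k) - N ^ 2 * (k 1 : ℝ) ^ 3 * k 2,
    N ^ 2 * (k 0 : ℝ) ^ 2 * (k 1 : ℝ) ^ 2 + N ^ 2 * (k 1 : ℝ) ^ 4]

/-- Symbol of the component `M_j` of the constitutive law `u = M[θ]`; it vanishes on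
`{k₃ = 0}`. -/
def velocitySymbol (N : ℝ) (j : Fin 3) (k : Freq) : ℂ :=
  if k 2 = 0 then 0 else ((velocityNumerator N k j / symbolD N k : ℝ) : ℂ)

/-- Symbol `|k|^{2γ}` of the fractional Laplacian `(-Δ)^γ`. -/
def fracLaplacianSymbol (γ : ℝ) (k : Freq) : ℝ := normSq k ^ γ

/-- The function `sin (m x₃)`. -/
def sinMode (m : ℕ) (y : Torus) : ℝ := (fourier (m : ℤ) (y 2) : ℂ).im

/-- The source term `S = ε m^{2γ} sin (m x₃)`, for which `sin (m x₃)` is a steady state. -/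
def source (ε γ : ℝ) (m : ℕ) (y : Torus) : ℝ := ε * (m : ℝ) ^ (2 * γ) * sinMode m y

/-- Zero vertical mean, `∫ f dx₃ = 0`: no Fourier modes on `{k₃ = 0}`. -/
def ZeroVerticalMean (f : Torus → ℝ) : Prop := ∀ k : Freq, k 2 = 0 → coeff f k = 0

/-- `θ ∈ L^∞(0,T;X)` is a (distributional) solution on `[0,T]` of
`∂_t θ + u·∇θ = -ε (-Δ)^γ θ + S`, `u = M[θ]`, `θ(0) = a`.
The fields `u` and `G = ∇θ` are the velocity and the gradient, and the equation, integrated in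
time, is tested on the characters of the torus. As usual for `L^∞(0,T;X)`, only the values of
`θ` at almost every time count. -/
def IsSolution (N ε γ : ℝ) (S : Torus → ℝ) (X : SobolevSpace) (T : ℝ) (a : Torus → ℝ)
    (θ : ℝ → Torus → ℝ) : Prop :=
  (∀ k, AEMeasurable (fun t => coeff (θ t) k) (volume.restrict (Set.Icc 0 T))) ∧
  (∃ C : ℝ≥0, ∀ᵐ t ∂(volume.restrict (Set.Icc 0 T)), X.norm (θ t) ≤ C) ∧
  ∃ u G : ℝ → Fin 3 → Torus → ℝ,
    (∀ᵐ t ∂(volume.restrict (Set.Icc 0 T)),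
      (∀ j, IsMultiplier (velocitySymbol N j) (θ t) (u t j)) ∧
      (∀ j, IsMultiplier (derivSymbol (Pi.single j 1)) (θ t) (G t j)) ∧
      Integrable (fun y => ∑ j, u t j y * G t j y) torusMeasure) ∧
    ∀ k,
      IntegrableOn (fun s => coeff (fun y => ∑ j, u s j y * G s j y) k) (Set.Icc 0 T) ∧
      ∀ᵐ t ∂(volume.restrict (Set.Icc 0 T)),
        coeff (θ t) k = coeff a k + ∫ s in (0 : ℝ)..t,
          (-coeff (fun y => ∑ j, u s j y * G s j y) k
            - (ε * fracLaplacianSymbol γ k : ℝ) * coeff (θ s) k + coeff S k)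

/-- `θ` is the unique solution on `[0,T]` in `L^∞(0,T;X)` with initial datum `a`. -/
def IsUniqueSolution (N ε γ : ℝ) (S : Torus → ℝ) (X : SobolevSpace) (T : ℝ) (a : Torus → ℝ)
    (θ : ℝ → Torus → ℝ) : Prop :=
  IsSolution N ε γ S X T a θ ∧
  ∀ θ' : ℝ → Torus → ℝ, IsSolution N ε γ S X T a θ' →
    ∀ᵐ t ∂(volume.restrict (Set.Icc 0 T)), θ' t =ᵐ[torusMeasure] θ t

/-- Local Lipschitz `(X,Y)` well-posedness of the Cauchy problem for the fractionally diffusive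
MG equation with source `S`. As throughout for this model, the initial data have zero vertical
mean. -/
def LocallyLipschitzWellPosed (N ε γ : ℝ) (S : Torus → ℝ) (X Y : SobolevSpace) : Prop :=
  ∃ T K : ℝ≥0 × ℝ≥0 → ℝ, Continuous T ∧ Continuous K ∧ (∀ r, 0 < T r) ∧ (∀ r, 0 < K r) ∧
    ∀ a b : Torus → ℝ, Y.Mem a → Y.Mem b → ZeroVerticalMean a → ZeroVerticalMean b →
      ∃ θ₁ θ₂ : ℝ → Torus → ℝ,
        IsUniqueSolution N ε γ S X (T ((Y.norm a).toNNReal, (Y.norm b).toNNReal)) a θ₁ ∧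
        IsUniqueSolution N ε γ S X (T ((Y.norm a).toNNReal, (Y.norm b).toNNReal)) b θ₂ ∧
        ∀ᵐ t ∂(volume.restrict
            (Set.Icc 0 (T ((Y.norm a).toNNReal, (Y.norm b).toNNReal)))),
          X.norm (θ₁ t - θ₂ t) ≤
            ENNReal.ofReal (K ((Y.norm a).toNNReal, (Y.norm b).toNNReal)) * Y.norm (a - b)

end MG

end

noncomputable section

namespace MG

open UnitAddTorus Filter Topology ComplexConjugate

/-! The profile `sin (m x₃)` is a steady state, and its linearisation has modes growing at a rate
tending to infinity with the frequency. A Lipschitz estimate from `Y` to `X` would only allow an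
amplification polynomial in the frequency.

The velocity of the steady state vanishes, so a perturbation feels only the term `m u₃ cos (m x₃)`,
which couples `k` to `k ± (0,0,m)`. On the chain `k_l = (j², j, m l)`, the coefficients satisfy
`c_l' = -(m/2) (μ_{l-1} c_{l-1} + μ_{l+1} c_{l+1}) - d_l c_l`, up to a quadratic remainder. Here
`μ_l ≥ 0` is the symbol of `M₃` and `μ_0 = 0`, so the chain is one-sided. On the parabola `k₁ = k₂²`
the multiplier `M₃` acts with its full order one: `μ_1` and `μ_2` are of size `j²`, comparable to
`|k|`, whereas `d_l ~ |k|^{2γ} ~ j^{4γ} = o(j²)` for `l = 1, 2` because `γ < 1/2`. In the variables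
`√μ_l c_l` the system is symmetric, and the datum `c_1 = -c_2` has a large Rayleigh quotient.
Expansion in eigenvectors and Jensen's inequality turn this quotient into exponential growth
(`growth_of_symmetric_system`, `chain_growth`).

The nonlinear problem is reached as follows. If it is well-posed, the solution from a datum at
distance of order `δ` from the steady state stays within `δ E` of it in `W^{1,4}`, with `E`
polynomial in `j`. The nonlinear remainder is then `O(δ²)` (`nonlinearity_near_sinMode`). The chain
is cut after `r + 2` modes; since `μ_l = O(l⁻²)`, the cut link is negligible against the losses from
the dimension. With `j` fixed, `δ = (r+1)⁻³` and `r → ∞`, both errors vanish relative to `δ`. What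
remains is `exp (mu T₀) ≤ C (P + 1)`, with `P` the `Y`-weight of the two frequencies
(`exists_exp_le_of_wellPosed`). Now `mu` grows at least linearly in `j` (`exists_growth_rate`) and
`P` at most polynomially, so letting `j → ∞` gives a contradiction. -/

/-! ### Fourier coefficients of integrable functions -/

theorem norm_mFourier_apply (k : Freq) (y : Torus) : ‖mFourier k y‖ = 1 := by
  simp only [mFourier, ContinuousMap.coe_mk, fourier_apply, norm_prod, Circle.norm_coe,
    Finset.prod_const_one]

theorem integral_mFourier (k : Freq) :
    ∫ y, mFourier k y ∂torusMeasure = if k = 0 then 1 else 0 := by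
  have h := orthonormal_iff_ite.1 (orthonormal_mFourier (d := Fin 3)) 0 k
  rw [ContinuousMap.inner_toLp] at h
  simp only [mFourier_zero, ContinuousMap.one_apply, map_one, mul_one] at h
  simp only [eq_comm (a := (0 : Fin 3 → ℤ))] at h
  exact h

theorem mFourierCoeff_eq (f : Torus → ℂ) (k : Freq) :
    mFourierCoeff f k = ∫ y, mFourier (-k) y * f y ∂torusMeasure := rfl

theorem coeff_eq (f : Torus → ℝ) (k : Freq) :
    coeff f k = ∫ y, mFourier (-k) y * (f y : ℂ) ∂torusMeasure := rfl

theorem Integrable.mFourier_mul {f : Torus → ℂ} (hf : Integrable f torusMeasure) (k : Freq) :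
    Integrable (fun y => mFourier k y * f y) torusMeasure :=
  hf.bdd_mul (c := 1) (mFourier k).continuous.aestronglyMeasurable
    (.of_forall fun y => (norm_mFourier_apply k y).le)

theorem integrable_coe {f : Torus → ℝ} (hf : Integrable f torusMeasure) :
    Integrable (fun y => (f y : ℂ)) torusMeasure := hf.ofReal

theorem coeff_congr_ae {f g : Torus → ℝ} (h : f =ᵐ[torusMeasure] g) (k : Freq) :
    coeff f k = coeff g k :=
  integral_congr_ae (by filter_upwards [h] with y hy; simp [hy])

theorem coeff_sub {f g : Torus → ℝ} (hf : Integrable f torusMeasure)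
    (hg : Integrable g torusMeasure) (k : Freq) :
    coeff (fun y => f y - g y) k = coeff f k - coeff g k := by
  rw [coeff_eq, coeff_eq, coeff_eq, ← integral_sub (Integrable.mFourier_mul (integrable_coe hf) (-k))
    (Integrable.mFourier_mul (integrable_coe hg) (-k))]
  congr 1; ext y; push_cast; exact mul_sub _ _ _

theorem coeff_const_mul (c : ℝ) (f : Torus → ℝ) (k : Freq) :
    coeff (fun y => c * f y) k = c * coeff f k := by
  rw [coeff_eq, coeff_eq, ← integral_const_mul]
  congr 1; ext y; push_cast; ring

theorem coeff_sum {ι : Type*} (s : Finset ι) {f : ι → Torus → ℝ}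
    (hf : ∀ i ∈ s, Integrable (f i) torusMeasure) (k : Freq) :
    coeff (fun y => ∑ i ∈ s, f i y) k = ∑ i ∈ s, coeff (f i) k := by
  simp_rw [coeff_eq]
  rw [← integral_finsetSum s fun i hi => Integrable.mFourier_mul (integrable_coe (hf i hi)) (-k)]
  congr 1; ext y; push_cast; rw [Finset.mul_sum]

theorem norm_coeff_le_integral (f : Torus → ℝ) (k : Freq) :
    ‖coeff f k‖ ≤ ∫ y, |f y| ∂torusMeasure := by
  refine (norm_integral_le_integral_norm _).trans_eq (integral_congr_ae (.of_forall fun y => ?_))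
  change ‖mFourier (-k) y * (f y : ℂ)‖ = |f y|
  rw [norm_mul, norm_mFourier_apply, one_mul, Complex.norm_real, Real.norm_eq_abs]

/-- An integrable function all of whose Fourier coefficients vanish is zero. -/
theorem ae_eq_zero_of_mFourierCoeff_eq_zero {f : Torus → ℂ} (hf : Integrable f torusMeasure)
    (h : ∀ k, mFourierCoeff f k = 0) : f =ᵐ[torusMeasure] 0 := by
  have hint : ∀ φ : C(Torus, ℂ), Integrable (fun y => φ y * f y) torusMeasure := fun φ =>
    hf.bdd_mul (c := ‖φ‖) φ.continuous.aestronglyMeasurable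
      (.of_forall fun y => φ.norm_coe_le_norm y)
  let L : C(Torus, ℂ) →ₗ[ℂ] ℂ :=
    { toFun := fun φ => ∫ y, φ y * f y ∂torusMeasure
      map_add' := fun φ ψ => by
        rw [← integral_add (hint φ) (hint ψ)]
        congr 1; ext y; simp [add_mul]
      map_smul' := fun c φ => by
        simp only [ContinuousMap.smul_apply, smul_eq_mul, RingHom.id_apply, mul_assoc]
        exact integral_const_mul _ _ }
  have hLb : ∀ φ, ‖L φ‖ ≤ (∫ y, ‖f y‖ ∂torusMeasure) * ‖φ‖ := by
    intro φ
    refine (norm_integral_le_integral_norm _).trans ?_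
    rw [← integral_mul_const]
    refine integral_mono (hint φ).norm (hf.norm.mul_const _) fun y => ?_
    dsimp only
    rw [norm_mul, mul_comm]
    exact mul_le_mul_of_nonneg_left (φ.norm_coe_le_norm y) (norm_nonneg _)
  let Lc : C(Torus, ℂ) →L[ℂ] ℂ := L.mkContinuous _ hLb
  -- Integration against `f` is a continuous functional on `C(Torus, ℂ)` that kills the characters,
  -- whose span is dense.
  have hL0 : Lc = 0 := by
    have hker : (⊤ : Submodule ℂ C(Torus, ℂ)) ≤ LinearMap.ker (Lc : C(Torus, ℂ) →ₗ[ℂ] ℂ) := by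
      rw [← span_mFourier_closure_eq_top]
      refine Submodule.topologicalClosure_minimal _ ?_ Lc.isClosed_ker
      rw [Submodule.span_le]
      rintro _ ⟨k, rfl⟩
      have := h (-k)
      rw [mFourierCoeff_eq, neg_neg] at this
      exact this
    ext1 φ
    exact hker (Submodule.mem_top (x := φ))
  have hzero : ∀ φ : C(Torus, ℂ), ∫ y, φ y * f y ∂torusMeasure = 0 := fun φ =>
    congrArg (fun l : C(Torus, ℂ) →L[ℂ] ℂ => l φ) hL0
  -- Closed sets suffice, and their indicators are bounded pointwise limits of continuous functions.
  refine ae_eq_zero_of_forall_setIntegral_isClosed_eq_zero hf fun s hs => ?_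
  have hδ : ∀ n : ℕ, (0 : ℝ) < 1 / ((n : ℝ) + 1) := fun n => by positivity
  let θ : ℕ → Torus → ℝ≥0 := fun n => thickenedIndicator (hδ n) s
  have hlim : Tendsto (fun n => ∫ y, ((θ n y : ℝ) : ℂ) * f y ∂torusMeasure) atTop
      (𝓝 (∫ y, s.indicator f y ∂torusMeasure)) := by
    refine tendsto_integral_of_dominated_convergence (fun y => ‖f y‖) (fun n => ?_) hf.norm
      (fun n => .of_forall fun y => ?_) (.of_forall fun y => ?_)
    · refine AEStronglyMeasurable.mul ?_ hf.1
      exact (Complex.continuous_ofReal.comp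
        (NNReal.continuous_coe.comp (thickenedIndicator (hδ n) s).continuous)).aestronglyMeasurable
    · rw [norm_mul, Complex.norm_real, Real.norm_eq_abs, abs_of_nonneg (NNReal.coe_nonneg _)]
      refine mul_le_of_le_one_left (norm_nonneg _) ?_
      exact NNReal.coe_le_one.2 (thickenedIndicator_le_one (hδ n) s y)
    · have h1 := thickenedIndicator_tendsto_indicator_closure hδ
        tendsto_one_div_add_atTop_nhds_zero_nat s
      rw [hs.closure_eq] at h1
      have h2 := (tendsto_pi_nhds.1 h1) y
      have h3 : Tendsto (fun n => ((θ n y : ℝ) : ℂ) * f y) atTop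
          (𝓝 (((s.indicator (fun _ => (1 : ℝ≥0)) y : ℝ≥0) : ℝ) * f y)) :=
        ((Complex.continuous_ofReal.tendsto _).comp
          ((NNReal.continuous_coe.tendsto _).comp h2)).mul_const _
      convert h3 using 2
      by_cases hy : y ∈ s <;> simp [hy]
  have hz : ∀ n, ∫ y, ((θ n y : ℝ) : ℂ) * f y ∂torusMeasure = 0 := fun n =>
    hzero ⟨fun y => ((θ n y : ℝ) : ℂ), Complex.continuous_ofReal.comp
      (NNReal.continuous_coe.comp (thickenedIndicator (hδ n) s).continuous)⟩
  rw [← integral_indicator hs.measurableSet]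
  simp_rw [hz] at hlim
  exact tendsto_nhds_unique hlim tendsto_const_nhds

theorem ae_eq_of_coeff_eq {f g : Torus → ℝ} (hf : Integrable f torusMeasure)
    (hg : Integrable g torusMeasure) (h : ∀ k, coeff f k = coeff g k) : f =ᵐ[torusMeasure] g := by
  have h0 := ae_eq_zero_of_mFourierCoeff_eq_zero (f := fun y => ((f y - g y : ℝ) : ℂ))
    (integrable_coe (hf.sub hg)) fun k => by
      change coeff (fun y => f y - g y) k = 0
      rw [coeff_sub hf hg, h, sub_self]
  filter_upwards [h0] with y hy
  have : f y - g y = 0 := Complex.ofReal_eq_zero.1 hy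
  linarith

/-- Parseval's identity. -/
theorem hasSum_sq_norm_coeff {f : Torus → ℝ} (hf : MemLp f 2 torusMeasure) :
    HasSum (fun k => ‖coeff f k‖ ^ 2) (∫ y, f y ^ 2 ∂torusMeasure) := by
  have hfc : MemLp (fun y => (f y : ℂ)) 2 torusMeasure := hf.ofReal
  have h := hasSum_sq_mFourierCoeff (d := Fin 3) (hfc.toLp _)
  have e1 : ∀ k, mFourierCoeff (hfc.toLp _) k = coeff f k := fun k =>
    integral_congr_ae (by
      filter_upwards [hfc.coeFn_toLp] with y hy
      rw [hy])
  have e2 : ∫ y, ‖(hfc.toLp _) y‖ ^ 2 ∂torusMeasure = ∫ y, f y ^ 2 ∂torusMeasure :=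
    integral_congr_ae (by
      filter_upwards [hfc.coeFn_toLp] with y hy
      rw [hy, Complex.norm_real, Real.norm_eq_abs, sq_abs])
  simp_rw [e1] at h
  rw [← e2]
  exact h

/-- An integrable function with square summable Fourier coefficients is square integrable. -/
theorem memLp_two_of_summable_coeff {f : Torus → ℝ} (hf : Integrable f torusMeasure)
    (h : Summable fun k => ‖coeff f k‖ ^ 2) : MemLp f 2 torusMeasure := by
  have hℓ : Memℓp (fun k => coeff f k) 2 := by
    rw [memℓp_gen_iff (by norm_num)]
    simpa using h
  -- Riesz–Fischer gives an `L²` function with the same coefficients; uniqueness in `L¹` identifies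
  -- it with `f`.
  let F := (mFourierBasis (d := Fin 3)).repr.symm ⟨_, hℓ⟩
  have hFc : ∀ k, mFourierCoeff F k = coeff f k := by
    intro k
    rw [← mFourierBasis_repr]
    simp [F]
  have hF2 : MemLp F 2 torusMeasure := Lp.memLp F
  have hF1 : Integrable F torusMeasure := hF2.integrable (by norm_num)
  have h0 := ae_eq_zero_of_mFourierCoeff_eq_zero (f := fun y => (f y : ℂ) - F y)
    ((integrable_coe hf).sub hF1) fun k => by
      have h1 : mFourierCoeff (fun y => (f y : ℂ) - F y) k = coeff f k - mFourierCoeff F k := by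
        rw [mFourierCoeff_eq, mFourierCoeff_eq, coeff_eq,
          ← integral_sub (Integrable.mFourier_mul (integrable_coe hf) (-k)) (Integrable.mFourier_mul hF1 (-k))]
        congr 1; ext y; ring
      rw [h1, hFc, sub_self]
  have h2 : MemLp (fun y => (f y : ℂ)) 2 torusMeasure := by
    refine (memLp_congr_ae ?_).1 hF2
    filter_upwards [h0] with y hy
    exact (sub_eq_zero.1 hy).symm
  simpa using h2.re

/-! ### Trigonometric polynomials and their Sobolev norms -/

/-- The real trigonometric monomial `Re (z e^{i κ·x})`. -/
def mode (z : ℂ) (κ : Freq) (y : Torus) : ℝ := (z * mFourier κ y).re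

theorem continuous_mode (z : ℂ) (κ : Freq) : Continuous (mode z κ) :=
  Complex.continuous_re.comp (continuous_const.mul (mFourier κ).continuous)

theorem abs_mode_le (z : ℂ) (κ : Freq) (y : Torus) : |mode z κ y| ≤ ‖z‖ := by
  refine (Complex.abs_re_le_norm _).trans ?_
  rw [norm_mul, norm_mFourier_apply, mul_one]

theorem integrable_mode (z : ℂ) (κ : Freq) : Integrable (mode z κ) torusMeasure :=
  Integrable.of_bound (continuous_mode z κ).aestronglyMeasurable ‖z‖
    (.of_forall fun y => abs_mode_le z κ y)

theorem mode_eq (z : ℂ) (κ : Freq) (y : Torus) :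
    (mode z κ y : ℂ) = (z * mFourier κ y + conj z * mFourier (-κ) y) / 2 := by
  rw [mode, mFourier_neg, ← map_mul, Complex.add_conj]; push_cast; ring

/-- Multiplication by a trigonometric monomial shifts the Fourier coefficients. -/
theorem coeff_mul_mode {f : Torus → ℝ} (hf : Integrable f torusMeasure) (z : ℂ) (κ k : Freq) :
    coeff (fun y => f y * mode z κ y) k =
      (z * coeff f (k - κ) + conj z * coeff f (k + κ)) / 2 := by
  rw [coeff_eq, coeff_eq, coeff_eq, ← integral_const_mul, ← integral_const_mul,
    ← integral_add ((Integrable.mFourier_mul (integrable_coe hf) _).const_mul _)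
      ((Integrable.mFourier_mul (integrable_coe hf) _).const_mul _), ← integral_div]
  congr 1; ext y
  have e1 : -(k - κ) = -k + κ := by abel
  have e2 : -(k + κ) = -k + -κ := by abel
  rw [e1, e2, mFourier_add, mFourier_add]
  push_cast
  rw [mode_eq]; ring

theorem coeff_one (k : Freq) : coeff (fun _ => 1) k = if k = 0 then 1 else 0 := by
  rw [coeff_eq]
  simp only [Complex.ofReal_one, mul_one]
  rw [integral_mFourier]; simp

theorem coeff_mode (z : ℂ) (κ k : Freq) :
    coeff (mode z κ) k =
      (z * (if k = κ then 1 else 0) + conj z * (if k = -κ then 1 else 0)) / 2 := by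
  have h := coeff_mul_mode (integrable_const (1 : ℝ)) z κ k
  simp only [one_mul] at h
  rw [show mode z κ = fun y => mode z κ y from rfl, h, coeff_one, coeff_one]
  simp only [sub_eq_zero, ← eq_neg_iff_add_eq_zero]

theorem normSq_nonneg (k : Freq) : 0 ≤ normSq k := Finset.sum_nonneg fun _ _ => sq_nonneg _

theorem normSq_neg (k : Freq) : normSq (-k) = normSq k := by simp [normSq]

theorem derivSymbol_neg (α : Fin 3 → ℕ) (k : Freq) :
    derivSymbol α (-k) = conj (derivSymbol α k) := by
  simp [derivSymbol]

theorem besselSymbol_neg (s : ℝ) (k : Freq) : besselSymbol s (-k) = conj (besselSymbol s k) := by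
  simp [besselSymbol, normSq_neg]

/-- The real trigonometric polynomial `∑ᵢ Re (zᵢ e^{i κᵢ·x})`. -/
def trig {ι : Type*} [Fintype ι] (z : ι → ℂ) (κ : ι → Freq) (y : Torus) : ℝ :=
  ∑ i, mode (z i) (κ i) y

section Trig

variable {ι : Type*} [Fintype ι]

theorem integrable_trig (z : ι → ℂ) (κ : ι → Freq) : Integrable (trig z κ) torusMeasure :=
  integrable_finsetSum _ fun i _ => integrable_mode (z i) (κ i)

theorem abs_trig_le (z : ι → ℂ) (κ : ι → Freq) (y : Torus) : |trig z κ y| ≤ ∑ i, ‖z i‖ :=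
  (Finset.abs_sum_le_sum_abs _ _).trans (Finset.sum_le_sum fun i _ => abs_mode_le (z i) (κ i) y)

theorem coeff_trig (z : ι → ℂ) (κ : ι → Freq) (k : Freq) :
    coeff (trig z κ) k = ∑ i, (z i * (if k = κ i then 1 else 0) +
      conj (z i) * (if k = -κ i then 1 else 0)) / 2 := by
  simp_rw [← coeff_mode]
  exact coeff_sum _ (fun i _ => integrable_mode (z i) (κ i)) k

theorem isMultiplier_trig {σ : Freq → ℂ} (hσ : ∀ k, σ (-k) = conj (σ k)) (z : ι → ℂ)
    (κ : ι → Freq) : IsMultiplier σ (trig z κ) (trig (fun i => σ (κ i) * z i) κ) := by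
  refine ⟨integrable_trig _ _, integrable_trig _ _, fun k => ?_⟩
  rw [coeff_trig, coeff_trig, Finset.mul_sum]
  refine Finset.sum_congr rfl fun i _ => ?_
  have h1 : σ (κ i) * (if k = κ i then 1 else 0) = σ k * (if k = κ i then 1 else 0) := by
    split_ifs with h
    · rw [h]
    · simp
  have h2 : conj (σ (κ i)) * (if k = -κ i then 1 else 0) =
      σ k * (if k = -κ i then 1 else 0) := by
    split_ifs with h
    · rw [h, hσ]
    · simp
  rw [map_mul]
  linear_combination (z i / 2) * h1 + (conj (z i) / 2) * h2

/-- The torus has mass one, so the sup norm dominates every `L^p` norm. This crude bound treats all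
exponents at once, including `p = 1` and `p = ∞`; polynomial growth in the frequency is all that is
needed later. -/
theorem multiplierNorm_trig_le {σ : Freq → ℂ} (hσ : ∀ k, σ (-k) = conj (σ k)) (p : ℝ≥0∞)
    (z : ι → ℂ) (κ : ι → Freq) :
    multiplierNorm σ p (trig z κ) ≤ ENNReal.ofReal (∑ i, ‖σ (κ i)‖ * ‖z i‖) := by
  refine (iInf₂_le _ (isMultiplier_trig hσ z κ)).trans ?_
  refine (eLpNorm_le_of_ae_bound (C := ∑ i, ‖σ (κ i)‖ * ‖z i‖) (.of_forall fun y => ?_)).trans ?_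
  · rw [Real.norm_eq_abs]
    refine (abs_trig_le _ _ y).trans_eq ?_
    simp_rw [norm_mul]
  · simp

/-- The weight of the frequency `κ` in the norm of a Sobolev space. -/
def SobolevSpace.weight : SobolevSpace → Freq → ℝ
  | .W n _ _, κ => ∑ α ∈ multiIndices n, ‖derivSymbol α κ‖
  | .H s _ _ _, κ => ‖besselSymbol s κ‖

theorem SobolevSpace.weight_nonneg (X : SobolevSpace) (κ : Freq) : 0 ≤ X.weight κ := by
  cases X
  · exact Finset.sum_nonneg fun _ _ => norm_nonneg _
  · exact norm_nonneg _

theorem SobolevSpace.norm_trig_le (X : SobolevSpace) (z : ι → ℂ) (κ : ι → Freq) :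
    X.norm (trig z κ) ≤ ENNReal.ofReal (∑ i, X.weight (κ i) * ‖z i‖) := by
  cases X with
  | W n p hp =>
    refine (Finset.sum_le_sum fun α _ =>
      multiplierNorm_trig_le (derivSymbol_neg α) p z κ).trans_eq ?_
    rw [← ENNReal.ofReal_sum_of_nonneg fun α _ => by positivity, Finset.sum_comm]
    simp_rw [weight, Finset.sum_mul]
  | H s p hp hp' => exact multiplierNorm_trig_le (besselSymbol_neg s) p z κ

end Trig

theorem abs_le_one_add_normSq (k : Freq) (j : Fin 3) : |(k j : ℝ)| ≤ 1 + normSq k := by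
  have h1 : (k j : ℝ) ^ 2 ≤ normSq k :=
    Finset.single_le_sum (f := fun j => (k j : ℝ) ^ 2) (fun _ _ => sq_nonneg _)
      (Finset.mem_univ j)
  have h2 : |(k j : ℝ)| ≤ 1 + (k j : ℝ) ^ 2 := by
    rw [← sq_abs]; nlinarith [sq_nonneg (|(k j : ℝ)| - 1)]
  linarith

/-- The weights of a Sobolev space grow at most polynomially. -/
theorem SobolevSpace.exists_weight_le (X : SobolevSpace) :
    ∃ C : ℝ, ∃ n : ℕ, 0 ≤ C ∧ ∀ κ, X.weight κ ≤ C * (1 + normSq κ) ^ n := by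
  cases X with
  | W n p hp =>
    refine ⟨(multiIndices n).card, n, by positivity, fun κ => ?_⟩
    rw [weight, ← nsmul_eq_mul]
    refine Finset.sum_le_card_nsmul _ _ _ fun α hα => ?_
    have hα' : ∑ j, α j ≤ n := (Finset.mem_filter.1 hα).2
    have h1 : 1 ≤ 1 + normSq κ := by linarith [normSq_nonneg κ]
    calc ‖derivSymbol α κ‖ = ∏ j, |(κ j : ℝ)| ^ α j := by
          rw [derivSymbol, norm_prod]
          refine Finset.prod_congr rfl fun j _ => ?_
          rw [norm_pow, norm_mul, Complex.norm_I, one_mul, Complex.norm_intCast]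
      _ ≤ ∏ j, (1 + normSq κ) ^ α j := Finset.prod_le_prod (fun _ _ => by positivity)
          fun j _ => pow_le_pow_left₀ (abs_nonneg _) (abs_le_one_add_normSq κ j) _
      _ = (1 + normSq κ) ^ ∑ j, α j := Finset.prod_pow_eq_pow_sum _ _ _
      _ ≤ _ := pow_le_pow_right₀ h1 hα'
  | H s p hp hp' =>
    refine ⟨1, ⌈(s : ℝ) / 2⌉₊, zero_le_one, fun κ => ?_⟩
    have h1 : 1 ≤ 1 + normSq κ := by linarith [normSq_nonneg κ]
    rw [weight, besselSymbol, Complex.norm_real, Real.norm_eq_abs,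
      abs_of_nonneg (Real.rpow_nonneg (by linarith) _), one_mul, ← Real.rpow_natCast]
    exact Real.rpow_le_rpow_of_exponent_le h1 (Nat.le_ceil _)

/-! ### Bounds for the symbols of the constitutive law -/

theorem symbolD_pos {N : ℝ} (hN : 0 < N) {k : Freq} (hk : k 2 ≠ 0) : 0 < symbolD N k := by
  have h2 : (0 : ℝ) < (k 2 : ℝ) ^ 2 := by positivity
  have hS : 0 < normSq k := by
    rw [normSq, Fin.sum_univ_three]; positivity
  unfold symbolD; positivity

/-- The constitutive law is an operator of order at most one. -/
theorem norm_velocitySymbol_sq_le {N : ℝ} (hN : 0 < N) (j : Fin 3) (k : Freq) :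
    ‖velocitySymbol N j k‖ ^ 2 ≤ 4 * normSq k := by
  by_cases hk : k 2 = 0
  · simp [velocitySymbol, hk, normSq_nonneg]
  have hD := symbolD_pos hN hk
  have hS0 := normSq_nonneg k
  rw [velocitySymbol, if_neg hk, Complex.norm_real, Real.norm_eq_abs, abs_div, abs_of_pos hD,
    div_pow, div_le_iff₀ (by positivity)]
  suffices h : |velocityNumerator N k j| ≤ 2 * √(normSq k) * symbolD N k by
    calc |velocityNumerator N k j| ^ 2 ≤ (2 * √(normSq k) * symbolD N k) ^ 2 :=
          pow_le_pow_left₀ (abs_nonneg _) h 2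
      _ = 4 * √(normSq k) ^ 2 * symbolD N k ^ 2 := by ring
      _ = _ := by rw [Real.sq_sqrt hS0]
  -- Integrality of `k₃ ≠ 0` is essential: it keeps the denominator from degenerating, and powers of
  -- `|k₃| ≥ 1` can be inserted freely below.
  have hc1 : (1 : ℝ) ≤ |(k 2 : ℝ)| := by
    rw [← Int.cast_abs]; exact_mod_cast Int.one_le_abs hk
  have hle : ∀ i, |(k i : ℝ)| ≤ √(normSq k) := fun i =>
    Real.abs_le_sqrt (Finset.single_le_sum (f := fun j => (k j : ℝ) ^ 2) (fun _ _ => sq_nonneg _)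
      (Finset.mem_univ i))
  have hSq : normSq k = √(normSq k) ^ 2 := (Real.sq_sqrt hS0).symm
  have hSsum : normSq k = (k 0 : ℝ) ^ 2 + (k 1 : ℝ) ^ 2 + (k 2 : ℝ) ^ 2 := by
    rw [normSq, Fin.sum_univ_three]
  have hDdef : symbolD N k = N ^ 4 * √(normSq k) ^ 2 * |(k 2 : ℝ)| ^ 2 + |(k 1 : ℝ)| ^ 4 := by
    rw [← hSq, sq_abs, Even.pow_abs (by decide), symbolD]
  have ha := hle 0
  have hb := hle 1
  have hc := hle 2
  have ha0 := abs_nonneg (k 0 : ℝ)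
  have hb0 := abs_nonneg (k 1 : ℝ)
  set s := √(normSq k) with hs
  set a := |(k 0 : ℝ)|
  set b := |(k 1 : ℝ)|
  set c := |(k 2 : ℝ)|
  have hs1 : 1 ≤ s := hc1.trans hc
  have hN2 : 0 < N ^ 2 := by positivity
  -- arithmetic-geometric mean inequality for the denominator
  have hamgm : 2 * (N ^ 2 * s * c * b ^ 2) ≤ symbolD N k := by
    rw [hDdef]; nlinarith [sq_nonneg (N ^ 2 * s * c - b ^ 2)]
  have hfirst : N ^ 4 * s ^ 2 * c ≤ symbolD N k := by
    rw [hDdef]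
    have h1 : N ^ 4 * s ^ 2 * c ≤ N ^ 4 * s ^ 2 * c ^ 2 :=
      mul_le_mul_of_nonneg_left (by nlinarith) (by positivity)
    linarith [pow_nonneg hb0 4]
  have hDs : symbolD N k ≤ s * symbolD N k := le_mul_of_one_le_left hD.le hs1
  have hpos : 0 ≤ N ^ 2 * c * b ^ 2 := by positivity
  fin_cases j
  · have e : |velocityNumerator N k 0| ≤ N ^ 4 * b * c * s ^ 2 + N ^ 2 * a * b ^ 2 * c := by
      simp only [velocityNumerator, Matrix.cons_val_zero]
      refine (abs_sub _ _).trans_eq ?_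
      rw [← hSq]
      simp [abs_mul, a, b, c, abs_of_nonneg hS0, abs_of_pos hN]
    refine e.trans ?_
    have h1 : N ^ 4 * b * c * s ^ 2 ≤ s * symbolD N k := by
      calc _ = b * (N ^ 4 * s ^ 2 * c) := by ring
        _ ≤ s * symbolD N k := mul_le_mul hb hfirst (by positivity) (by positivity)
    have h2 : N ^ 2 * a * b ^ 2 * c ≤ N ^ 2 * s * c * b ^ 2 := by
      calc _ = (N ^ 2 * c * b ^ 2) * a := by ring
        _ ≤ (N ^ 2 * c * b ^ 2) * s := mul_le_mul_of_nonneg_left ha hpos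
        _ = _ := by ring
    linarith
  · have e : |velocityNumerator N k 1| ≤ N ^ 4 * a * c * s ^ 2 + N ^ 2 * b ^ 3 * c := by
      simp only [velocityNumerator, Matrix.cons_val_one, Matrix.cons_val_zero]
      refine (abs_sub _ _).trans_eq ?_
      rw [← hSq]
      simp [abs_mul, a, b, c, abs_of_nonneg hS0, abs_of_pos hN]
    refine e.trans ?_
    have h1 : N ^ 4 * a * c * s ^ 2 ≤ s * symbolD N k := by
      calc _ = a * (N ^ 4 * s ^ 2 * c) := by ring
        _ ≤ s * symbolD N k := mul_le_mul ha hfirst (by positivity) (by positivity)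
    have h2 : N ^ 2 * b ^ 3 * c ≤ N ^ 2 * s * c * b ^ 2 := by
      calc _ = (N ^ 2 * c * b ^ 2) * b := by ring
        _ ≤ (N ^ 2 * c * b ^ 2) * s := mul_le_mul_of_nonneg_left hb hpos
        _ = _ := by ring
    linarith
  · have e : |velocityNumerator N k 2| = N ^ 2 * b ^ 2 * (a ^ 2 + b ^ 2) := by
      have : velocityNumerator N k 2 = N ^ 2 * b ^ 2 * (a ^ 2 + b ^ 2) := by
        simp only [velocityNumerator, Matrix.cons_val, a, b, sq_abs]; ring
      rw [this, abs_of_nonneg (by positivity)]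
    refine e.trans_le ?_
    have hab : a ^ 2 + b ^ 2 ≤ s ^ 2 := by
      rw [← hSq, hSsum]; simp only [a, b, sq_abs]; nlinarith [sq_nonneg (k 2 : ℝ)]
    calc N ^ 2 * b ^ 2 * (a ^ 2 + b ^ 2) ≤ N ^ 2 * b ^ 2 * s ^ 2 :=
          mul_le_mul_of_nonneg_left hab (by positivity)
      _ = s * (N ^ 2 * s * b ^ 2) * 1 := by ring
      _ ≤ s * (N ^ 2 * s * b ^ 2) * c := mul_le_mul_of_nonneg_left hc1 (by positivity)
      _ = s * (N ^ 2 * s * c * b ^ 2) := by ring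
      _ ≤ s * symbolD N k := mul_le_mul_of_nonneg_left
          (by have : 0 ≤ N ^ 2 * s * c * b ^ 2 := by positivity
              linarith) (by positivity)
      _ ≤ 2 * s * symbolD N k := by nlinarith [mul_pos (lt_of_lt_of_le one_pos hs1) hD]

/-- The frequency `(j², j, m l)`. -/
def waveVec (j m l : ℕ) : Freq := ![(j : ℤ) ^ 2, (j : ℤ), (m : ℤ) * l]

theorem normSq_waveVec (j m l : ℕ) :
    normSq (waveVec j m l) = (j : ℝ) ^ 4 + (j : ℝ) ^ 2 + (m : ℝ) ^ 2 * (l : ℝ) ^ 2 := by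
  rw [normSq, Fin.sum_univ_three]; simp [waveVec]; ring

/-- The symbol of `M₃` on the frequencies `(j², j, m l)`. -/
def waveSymbol (N : ℝ) (j m l : ℕ) : ℝ :=
  if l = 0 then 0 else N ^ 2 * (j : ℝ) ^ 2 * ((j : ℝ) ^ 4 + (j : ℝ) ^ 2) /
    (N ^ 4 * ((j : ℝ) ^ 4 + (j : ℝ) ^ 2 + (m : ℝ) ^ 2 * (l : ℝ) ^ 2) * ((m : ℝ) ^ 2 * (l : ℝ) ^ 2)
      + (j : ℝ) ^ 4)

theorem velocitySymbol_waveVec (N : ℝ) {j m : ℕ} (hm : 1 ≤ m) (l : ℕ) :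
    velocitySymbol N 2 (waveVec j m l) = (waveSymbol N j m l : ℂ) := by
  have h : waveVec j m l 2 = 0 ↔ l = 0 := by
    simp [waveVec]; omega
  rw [velocitySymbol, waveSymbol]
  by_cases hl : l = 0
  · rw [if_pos (h.2 hl), if_pos hl]; simp
  · rw [if_neg (mt h.1 hl), if_neg hl, symbolD, normSq_waveVec]
    congr 1
    simp [velocityNumerator, waveVec]
    ring

theorem waveSymbol_zero (N : ℝ) (j m : ℕ) : waveSymbol N j m 0 = 0 := if_pos rfl

theorem waveSymbol_nonneg (N : ℝ) (j m l : ℕ) : 0 ≤ waveSymbol N j m l := by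
  rw [waveSymbol]; split_ifs <;> positivity

/-- The denominator contains `N⁴ (j⁴ + j²) (m l)²`, which cancels the factor `j⁴ + j²` of the
numerator. The resulting decay `l⁻²` makes truncation of the chain harmless. -/
theorem waveSymbol_mul_sq_le {N : ℝ} (hN : 0 < N) {j m : ℕ} (hm : 1 ≤ m) (hj : 1 ≤ j) (l : ℕ) :
    waveSymbol N j m l * (l : ℝ) ^ 2 ≤ (j : ℝ) ^ 2 / N ^ 2 := by
  rw [waveSymbol]
  have hm' : (1 : ℝ) ≤ m := by exact_mod_cast hm
  have hj' : (1 : ℝ) ≤ j := by exact_mod_cast hj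
  split_ifs with hl
  · simp only [zero_mul]; positivity
  · have hl' : (0 : ℝ) < l := by exact_mod_cast Nat.pos_of_ne_zero hl
    rw [div_mul_eq_mul_div, div_le_div_iff₀ (by positivity) (by positivity)]
    have h1 : (l : ℝ) ^ 2 ≤ (m : ℝ) ^ 2 * (l : ℝ) ^ 2 :=
      le_mul_of_one_le_left (by positivity) (by nlinarith)
    have h2 : N ^ 4 * ((j : ℝ) ^ 4 + (j : ℝ) ^ 2) * (l : ℝ) ^ 2 ≤
        N ^ 4 * ((j : ℝ) ^ 4 + (j : ℝ) ^ 2 + (m : ℝ) ^ 2 * (l : ℝ) ^ 2) *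
          ((m : ℝ) ^ 2 * (l : ℝ) ^ 2) + (j : ℝ) ^ 4 := by
      have h3 : N ^ 4 * ((j : ℝ) ^ 4 + (j : ℝ) ^ 2) * (l : ℝ) ^ 2 ≤
          N ^ 4 * ((j : ℝ) ^ 4 + (j : ℝ) ^ 2 + (m : ℝ) ^ 2 * (l : ℝ) ^ 2) *
          ((m : ℝ) ^ 2 * (l : ℝ) ^ 2) := by
        refine mul_le_mul ?_ h1 (by positivity) (by positivity)
        refine mul_le_mul_of_nonneg_left ?_ (by positivity)
        linarith [show 0 ≤ (m : ℝ) ^ 2 * (l : ℝ) ^ 2 by positivity]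
      linarith [show 0 ≤ (j : ℝ) ^ 4 by positivity]
    calc _ = (j : ℝ) ^ 2 * (N ^ 4 * ((j : ℝ) ^ 4 + (j : ℝ) ^ 2) * (l : ℝ) ^ 2) := by ring
      _ ≤ _ := mul_le_mul_of_nonneg_left h2 (by positivity)

theorem waveSymbol_le {N : ℝ} (hN : 0 < N) {j m : ℕ} (hm : 1 ≤ m) (hj : 1 ≤ j) (l : ℕ) :
    waveSymbol N j m l ≤ (j : ℝ) ^ 2 / N ^ 2 := by
  rcases Nat.eq_zero_or_pos l with rfl | hl
  · rw [waveSymbol_zero]; positivity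
  · refine le_trans ?_ (waveSymbol_mul_sq_le hN hm hj l)
    have : (1 : ℝ) ≤ l := by exact_mod_cast hl
    exact le_mul_of_one_le_right (waveSymbol_nonneg _ _ _ _) (by nlinarith)

/-- Here `(m l)² ≤ 4 m² ≤ j² ≤ j⁴`, so the denominator is at most `(12 N⁴ m² + 1) j⁴`, against a
numerator of at least `N² j⁶`. This is the source of the instability. -/
theorem le_waveSymbol {N : ℝ} {j m l : ℕ} (hm : 1 ≤ m) (hj : 2 * m ≤ j) (hl : 1 ≤ l)
    (hl2 : l ≤ 2) :
    N ^ 2 / (12 * N ^ 4 * (m : ℝ) ^ 2 + 1) * (j : ℝ) ^ 2 ≤ waveSymbol N j m l := by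
  have hm' : (1 : ℝ) ≤ m := by exact_mod_cast hm
  have hj' : 2 * (m : ℝ) ≤ j := by exact_mod_cast hj
  have hl' : (1 : ℝ) ≤ l := by exact_mod_cast hl
  have hl2' : (l : ℝ) ≤ 2 := by exact_mod_cast hl2
  have hj0 : (0 : ℝ) < j := by linarith
  rw [waveSymbol, if_neg (by omega), div_mul_eq_mul_div, div_le_div_iff₀ (by positivity)
    (by positivity)]
  have h1 : (m : ℝ) ^ 2 * (l : ℝ) ^ 2 ≤ 4 * (m : ℝ) ^ 2 := by
    have : (l : ℝ) ^ 2 ≤ 4 := by nlinarith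
    nlinarith [sq_nonneg (m : ℝ)]
  have h2 : 4 * (m : ℝ) ^ 2 ≤ (j : ℝ) ^ 2 := by nlinarith
  have h3 : (j : ℝ) ^ 2 ≤ (j : ℝ) ^ 4 := by
    have : 1 ≤ (j : ℝ) ^ 2 := by nlinarith
    nlinarith
  have h4 : N ^ 4 * ((j : ℝ) ^ 4 + (j : ℝ) ^ 2 + (m : ℝ) ^ 2 * (l : ℝ) ^ 2) *
      ((m : ℝ) ^ 2 * (l : ℝ) ^ 2) ≤ N ^ 4 * (3 * (j : ℝ) ^ 4) * (4 * (m : ℝ) ^ 2) := by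
    refine mul_le_mul ?_ h1 (by positivity) (by positivity)
    exact mul_le_mul_of_nonneg_left (by linarith) (by positivity)
  calc _ ≤ N ^ 2 * (j : ℝ) ^ 2 * (N ^ 4 * (3 * (j : ℝ) ^ 4) * (4 * (m : ℝ) ^ 2) + (j : ℝ) ^ 4) :=
        mul_le_mul_of_nonneg_left (by linarith) (by positivity)
    _ = N ^ 2 * (j : ℝ) ^ 2 * (j : ℝ) ^ 4 * (12 * N ^ 4 * (m : ℝ) ^ 2 + 1) := by ring
    _ ≤ N ^ 2 * (j : ℝ) ^ 2 * ((j : ℝ) ^ 4 + (j : ℝ) ^ 2) * (12 * N ^ 4 * (m : ℝ) ^ 2 + 1) := by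
        gcongr
        linarith [sq_nonneg (j : ℝ)]

theorem normSq_waveVec_le {j m l : ℕ} (hm : 1 ≤ m) (hj : 2 * m ≤ j) (hl2 : l ≤ 2) :
    normSq (waveVec j m l) ≤ 3 * (j : ℝ) ^ 4 := by
  have hm' : (1 : ℝ) ≤ m := by exact_mod_cast hm
  have hj' : 2 * (m : ℝ) ≤ j := by exact_mod_cast hj
  have hl2' : (l : ℝ) ≤ 2 := by exact_mod_cast hl2
  have hl0 : (0 : ℝ) ≤ l := by positivity
  have h1 : (m : ℝ) * l ≤ j := by nlinarith
  have h1' : (m : ℝ) ^ 2 * (l : ℝ) ^ 2 ≤ (j : ℝ) ^ 2 := by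
    rw [← mul_pow]; exact pow_le_pow_left₀ (by positivity) h1 2
  have h3 : (j : ℝ) ^ 2 ≤ (j : ℝ) ^ 4 := by
    have : 1 ≤ (j : ℝ) ^ 2 := by nlinarith
    nlinarith
  rw [normSq_waveVec]; linarith

/-! ### Forced linear systems: Duhamel's formula and growth in eigenvectors -/

/-- Duhamel estimate for the scalar integral equation `y' = lam y + g` holding at almost every
time. -/
theorem norm_sub_exp_mul_le_of_ae_integral_eq {T lam Lam η : ℝ} (hT : 0 ≤ T) (hLam : lam ≤ Lam)
    (hLam0 : 0 ≤ Lam) (hη : 0 ≤ η) {y g : ℝ → ℂ} {y₀ : ℂ}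
    (hy : IntegrableOn y (Set.Icc 0 T)) (hg : IntegrableOn g (Set.Icc 0 T))
    (hgη : ∀ᵐ t ∂(volume.restrict (Set.Icc 0 T)), ‖g t‖ ≤ η)
    (h : ∀ᵐ t ∂(volume.restrict (Set.Icc 0 T)),
      y t = y₀ + ∫ s in (0 : ℝ)..t, ((lam : ℂ) * y s + g s)) :
    ∀ᵐ t ∂(volume.restrict (Set.Icc 0 T)),
      ‖y t - Real.exp (lam * t) * y₀‖ ≤ 2 * η * T * Real.exp (Lam * T) := by
  set F : ℝ → ℂ := fun t => ∫ s in (0 : ℝ)..t, g s with hF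
  set Y : ℝ → ℂ := fun t => y₀ + ∫ s in (0 : ℝ)..t, ((lam : ℂ) * y s + g s) with hY
  have sub : ∀ t ∈ Set.Icc 0 T, Set.uIcc 0 t ⊆ Set.Icc 0 T := fun t ht => by
    rw [Set.uIcc_of_le ht.1]; exact Set.Icc_subset_Icc_right ht.2
  have hyi : ∀ t ∈ Set.Icc 0 T, IntervalIntegrable y volume 0 t := fun t ht =>
    (hy.mono_set (sub t ht)).intervalIntegrable
  have hgi : ∀ t ∈ Set.Icc 0 T, IntervalIntegrable g volume 0 t := fun t ht =>
    (hg.mono_set (sub t ht)).intervalIntegrable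
  have hFc : ContinuousOn F (Set.Icc 0 T) := by
    have := intervalIntegral.continuousOn_primitive_interval (μ := volume) (f := g) (a := 0) (b := T)
      (by rwa [Set.uIcc_of_le hT])
    rwa [Set.uIcc_of_le hT] at this
  have hI : IntegrableOn (fun s => (lam : ℂ) * y s + g s) (Set.Icc 0 T) :=
    (hy.const_mul _).add hg
  have hYc : ContinuousOn Y (Set.Icc 0 T) := by
    have := intervalIntegral.continuousOn_primitive_interval (μ := volume)
      (f := fun s => (lam : ℂ) * y s + g s) (a := 0) (b := T) (by rwa [Set.uIcc_of_le hT])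
    rw [Set.uIcc_of_le hT] at this
    exact continuousOn_const.add this
  have hae : ∀ᵐ t, t ∈ Set.Icc 0 T → y t = Y t :=
    (ae_restrict_iff' measurableSet_Icc).1 h
  have hgae : ∀ᵐ t, t ∈ Set.Icc 0 T → ‖g t‖ ≤ η :=
    (ae_restrict_iff' measurableSet_Icc).1 hgη
  have hFle : ∀ t ∈ Set.Icc 0 T, ‖F t‖ ≤ η * T := by
    intro t ht
    have : ‖F t‖ ≤ η * |t - 0| := by
      refine intervalIntegral.norm_integral_le_of_norm_le_const_ae ?_
      filter_upwards [hgae] with s hs hst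
      rw [Set.uIoc_of_le ht.1] at hst
      exact hs ⟨hst.1.le, hst.2.trans ht.2⟩
    rw [sub_zero, abs_of_nonneg ht.1] at this
    exact this.trans (mul_le_mul_of_nonneg_left ht.2 hη)
  -- the regular part of the solution
  set Z : ℝ → ℂ := fun t => y₀ + ∫ s in (0 : ℝ)..t, (lam : ℂ) * Y s with hZ
  have hYZ : ∀ t ∈ Set.Icc 0 T, Y t = Z t + F t := by
    intro t ht
    have e1 : Y t = y₀ + ((∫ s in (0 : ℝ)..t, (lam : ℂ) * y s) + ∫ s in (0 : ℝ)..t, g s) := by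
      rw [hY]; dsimp only
      rw [intervalIntegral.integral_add ((hyi t ht).const_mul _) (hgi t ht)]
    have e2 : (∫ s in (0 : ℝ)..t, (lam : ℂ) * y s) = ∫ s in (0 : ℝ)..t, (lam : ℂ) * Y s := by
      refine intervalIntegral.integral_congr_ae ?_
      filter_upwards [hae] with s hs hst
      rw [Set.uIoc_of_le ht.1] at hst
      rw [hs ⟨hst.1.le, hst.2.trans ht.2⟩]
    rw [e1, e2, hZ, hF]; ring
  have hYint : IntervalIntegrable (fun s => (lam : ℂ) * Y s) volume 0 T :=
    ContinuousOn.intervalIntegrable (by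
      rw [Set.uIcc_of_le hT]; exact continuousOn_const.mul hYc)
  have hZc : ContinuousOn Z (Set.Icc 0 T) := by
    have : ContinuousOn (fun t => Y t - F t) (Set.Icc 0 T) := hYc.sub hFc
    exact this.congr fun t ht => by simp [hYZ t ht]
  have hZd : ∀ t ∈ Set.Ico 0 T, HasDerivWithinAt Z ((lam : ℂ) * Y t) (Set.Ici t) t := by
    intro t ht
    have htc : t ∈ Set.Icc 0 T := ⟨ht.1, ht.2.le⟩
    have hcw : ContinuousWithinAt (fun s => (lam : ℂ) * Y s) (Set.Ioi t) t := by
      have := (continuousOn_const (c := (lam : ℂ))).mul hYc t htc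
      refine (this.mono_of_mem_nhdsWithin ?_)
      exact Filter.mem_of_superset (Ioo_mem_nhdsGT ht.2)
        fun s hs => ⟨ht.1.trans hs.1.le, hs.2.le⟩
    have hm : StronglyMeasurableAtFilter (fun s => (lam : ℂ) * Y s) (nhdsWithin t (Set.Ioi t)) := by
      refine ⟨Set.Ioo t T, Ioo_mem_nhdsGT ht.2, ?_⟩
      exact (((continuousOn_const (c := (lam : ℂ))).mul hYc).mono
        fun s hs => ⟨ht.1.trans hs.1.le, hs.2.le⟩).aestronglyMeasurable measurableSet_Ioo
    have := intervalIntegral.integral_hasDerivWithinAt_right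
      (hYint.mono_set (by
        rw [Set.uIcc_of_le hT, Set.uIcc_of_le ht.1]; exact Set.Icc_subset_Icc_right ht.2.le))
      (s := Set.Ici t) (t := Set.Ioi t) hm hcw
    exact this.const_add y₀
  -- Since `Z' = lam (Z + F)`, the integrating factor leaves `W' = exp (-lam t) lam F`; only the
  -- primitive `F` of the forcing enters.
  set W : ℝ → ℂ := fun t => (Real.exp (-lam * t) : ℂ) * Z t - y₀ with hW
  have hexpd : ∀ t : ℝ, HasDerivAt (fun t : ℝ => Real.exp (-lam * t))
      (Real.exp (-lam * t) * -lam) t := fun t => by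
    simpa using ((hasDerivAt_id t).const_mul (-lam)).exp
  have hWd : ∀ t ∈ Set.Ico 0 T, HasDerivWithinAt W
      ((Real.exp (-lam * t) : ℂ) * ((lam : ℂ) * F t)) (Set.Ici t) t := by
    intro t ht
    have h1 := ((hexpd t).ofReal_comp.hasDerivWithinAt (s := Set.Ici t)).mul (hZd t ht)
    have h2 := h1.sub_const y₀
    refine h2.congr_deriv ?_
    rw [hYZ t ⟨ht.1, ht.2.le⟩]; push_cast; ring
  -- With `sg` the sign of `lam`, the integral of `|lam| exp (-lam s)` over `[0,t]` is `sg (1 - exp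
  -- (-lam t))`. The final bound is thus free of `|lam|`, as required because dissipation can make
  -- eigenvalues very negative.
  obtain ⟨sg, hsg, hsg'⟩ : ∃ sg : ℝ, |sg| = 1 ∧ sg * lam = |lam| := by
    rcases le_total 0 lam with h0 | h0
    · exact ⟨1, by simp, by simp [abs_of_nonneg h0]⟩
    · exact ⟨-1, by simp, by simp [abs_of_nonpos h0]⟩
  have key : ∀ t ∈ Set.Icc 0 T, ‖W t‖ ≤ η * T * (sg * (1 - Real.exp (-lam * t))) := by
    intro t ht
    refine image_norm_le_of_norm_deriv_right_le_deriv_boundary (a := 0) (b := T) (f := W)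
      (f' := fun t => (Real.exp (-lam * t) : ℂ) * ((lam : ℂ) * F t)) ?_ hWd
      (B := fun t => η * T * (sg * (1 - Real.exp (-lam * t))))
      (B' := fun t => η * T * (Real.exp (-lam * t) * |lam|)) ?_ ?_ ?_ ht
    · have : ContinuousOn (fun t : ℝ => (Real.exp (-lam * t) : ℂ)) (Set.Icc 0 T) := by fun_prop
      exact (this.mul hZc).sub continuousOn_const
    · simp [hW, hZ]
    · intro t
      have := (((hexpd t).const_sub 1).const_mul sg).const_mul (η * T)
      refine this.congr_deriv ?_
      rw [← hsg']; ring
    · intro t ht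
      rw [norm_mul, norm_mul, Complex.norm_real, Complex.norm_real, Real.norm_eq_abs,
        Real.norm_eq_abs, abs_of_pos (Real.exp_pos _)]
      have := mul_le_mul_of_nonneg_left (hFle t ⟨ht.1, ht.2.le⟩)
        (mul_nonneg (Real.exp_pos (-lam * t)).le (abs_nonneg lam))
      linarith
  have hηT : 0 ≤ η * T := mul_nonneg hη hT
  filter_upwards [h, ae_restrict_mem measurableSet_Icc] with t ht htT
  have hE : Real.exp (lam * t) * Real.exp (-lam * t) = 1 := by
    rw [← Real.exp_add]; simp
  have hEc : (Real.exp (lam * t) : ℂ) * (Real.exp (-lam * t) : ℂ) = 1 := by exact_mod_cast hE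
  have e : y t - Real.exp (lam * t) * y₀ = Real.exp (lam * t) * W t + F t := by
    rw [ht]; change Y t - _ = _
    rw [hYZ t htT, hW]; dsimp only
    linear_combination (-(Z t)) * hEc
  have hel : Real.exp (lam * t) ≤ Real.exp (Lam * T) := Real.exp_le_exp.2 <|
    (mul_le_mul_of_nonneg_right hLam htT.1).trans (mul_le_mul_of_nonneg_left htT.2 hLam0)
  have h1 : 1 ≤ Real.exp (Lam * T) := Real.one_le_exp (mul_nonneg hLam0 hT)
  have h2 : |Real.exp (lam * t) - 1| + 1 ≤ 2 * Real.exp (Lam * T) := by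
    have := Real.exp_pos (lam * t)
    rcases abs_cases (Real.exp (lam * t) - 1) with ⟨h, _⟩ | ⟨h, _⟩ <;> rw [h] <;> linarith
  calc ‖y t - Real.exp (lam * t) * y₀‖
      ≤ Real.exp (lam * t) * ‖W t‖ + ‖F t‖ := by
        rw [e]; refine (norm_add_le _ _).trans ?_
        rw [norm_mul, Complex.norm_real, Real.norm_eq_abs, abs_of_pos (Real.exp_pos _)]
    _ ≤ Real.exp (lam * t) * (η * T * (sg * (1 - Real.exp (-lam * t)))) + η * T :=
        add_le_add (mul_le_mul_of_nonneg_left (key t htT) (Real.exp_pos _).le) (hFle t htT)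
    _ = η * T * (sg * (Real.exp (lam * t) - 1) + 1) := by
        linear_combination (-(η * T * sg)) * hE
    _ ≤ η * T * (|Real.exp (lam * t) - 1| + 1) := by
        refine mul_le_mul_of_nonneg_left (add_le_add_left ?_ 1) hηT
        refine (le_abs_self _).trans ?_
        rw [abs_mul, hsg, one_mul]
    _ ≤ η * T * (2 * Real.exp (Lam * T)) := mul_le_mul_of_nonneg_left h2 hηT
    _ = _ := by ring

/-- Gershgorin bound for the eigenvalues of a real symmetric matrix. -/
theorem eigenvalues_le_of_row_sum_le {n : Type*} [Fintype n] [DecidableEq n] {B : Matrix n n ℝ}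
    (hB : B.IsHermitian) {Lam : ℝ} (hrow : ∀ i, B i i + ∑ j ∈ Finset.univ.erase i, |B i j| ≤ Lam)
    (i : n) : hB.eigenvalues i ≤ Lam := by
  have h1 : Module.End.HasEigenvalue (Matrix.toLin' B) (hB.eigenvalues i) := by
    refine Module.End.hasEigenvalue_of_hasEigenvector (x := ⇑(hB.eigenvectorBasis i)) ?_
    refine ⟨?_, ?_⟩
    · rw [Module.End.mem_eigenspace_iff, Matrix.toLin'_apply]
      exact hB.mulVec_eigenvectorBasis i
    · intro h0
      exact hB.eigenvectorBasis.orthonormal.ne_zero i (by ext k; exact congrFun h0 k)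
  obtain ⟨k, hk⟩ := eigenvalue_mem_ball h1
  rw [Metric.mem_closedBall, Real.dist_eq] at hk
  have := (abs_le.1 hk).2
  simp only [Real.norm_eq_abs] at this
  linarith [hrow k]

/-- Lower bound for the growth of a forced linear system with real symmetric matrix, by expansion in
eigenvectors and Jensen's inequality. -/
theorem growth_of_symmetric_system {n : Type*} [Fintype n] [DecidableEq n] {B : Matrix n n ℝ}
    (hB : B.IsHermitian) {Lam T η mu : ℝ} (hT : 0 ≤ T) (hLam0 : 0 ≤ Lam) (hη : 0 ≤ η)
    (hrow : ∀ i, B i i + ∑ j ∈ Finset.univ.erase i, |B i j| ≤ Lam)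
    {x : n → ℝ} (hx : mu * ∑ i, x i ^ 2 ≤ ∑ i, x i * ∑ j, B i j * x j)
    {b f : ℝ → n → ℂ} {β : ℂ}
    (hb : ∀ i, IntegrableOn (fun t => b t i) (Set.Icc 0 T))
    (hf : ∀ i, IntegrableOn (fun t => f t i) (Set.Icc 0 T))
    (hfη : ∀ᵐ t ∂(volume.restrict (Set.Icc 0 T)), ∀ i, ‖f t i‖ ≤ η)
    (h : ∀ᵐ t ∂(volume.restrict (Set.Icc 0 T)), ∀ i,
      b t i = β * x i + ∫ s in (0 : ℝ)..t, (∑ j, (B i j : ℂ) * b s j + f s i)) :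
    ∀ᵐ t ∂(volume.restrict (Set.Icc 0 T)),
      ‖β‖ * ((∑ i, x i ^ 2) * Real.exp (mu * t)) ≤ ‖∑ i, (x i : ℂ) * b t i‖ +
        2 * (Fintype.card n : ℝ) ^ 2 * √(∑ i, x i ^ 2) * η * T * Real.exp (Lam * T) := by
  set v := hB.eigenvectorBasis with hv
  set lam := hB.eigenvalues with hlam
  set xe : EuclideanSpace ℝ n := WithLp.toLp 2 x with hxe
  set ξ : n → ℝ := fun i => ∑ l, v i l * x l with hξ
  have hξr : ∀ i, ξ i = v.repr xe i := by
    intro i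
    rw [v.repr_apply_apply, PiLp.inner_apply]
    simp [hξ, hxe, mul_comm]
  have hvle : ∀ i l, |v i l| ≤ 1 := by
    intro i l
    have := PiLp.norm_apply_le (v i) l
    rwa [v.orthonormal.1 i, Real.norm_eq_abs] at this
  have hBv : ∀ i l, ∑ j, B l j * v i j = lam i * v i l := by
    intro i l
    have := congrFun (hB.mulVec_eigenvectorBasis i) l
    simpa [Matrix.mulVec, dotProduct] using this
  have hBs : ∀ i j, B i j = B j i := fun i j => by
    simpa using congrFun (congrFun hB.symm i) j
  have hxexp : ∀ l, x l = ∑ i, ξ i * v i l := by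
    intro l
    have h1 := v.sum_repr xe
    have h2 := congrArg (fun z : EuclideanSpace ℝ n => z l) h1
    simp only [← hξr] at h2
    simpa [hxe] using h2.symm
  have hS : ∑ i, ξ i ^ 2 = ∑ i, x i ^ 2 := by
    have h1 := v.repr.norm_map xe
    rw [EuclideanSpace.norm_eq, EuclideanSpace.norm_eq, Real.sqrt_inj (by positivity)
      (by positivity)] at h1
    simp_rw [hξr]
    simpa [hxe] using h1
  have hSlam : ∑ i, lam i * ξ i ^ 2 = ∑ i, x i * ∑ j, B i j * x j := by
    have e1 : ∀ l, ∑ j, B l j * x j = ∑ i, ξ i * (lam i * v i l) := by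
      intro l
      calc ∑ j, B l j * x j = ∑ j, ∑ i, ξ i * (B l j * v i j) := by
            refine Finset.sum_congr rfl fun j _ => ?_
            rw [hxexp j, Finset.mul_sum]
            exact Finset.sum_congr rfl fun i _ => by ring
        _ = ∑ i, ξ i * ∑ j, B l j * v i j := by
            rw [Finset.sum_comm]; simp_rw [Finset.mul_sum]
        _ = _ := by simp_rw [hBv]
    simp_rw [e1, Finset.mul_sum]
    rw [Finset.sum_comm]
    refine Finset.sum_congr rfl fun i _ => ?_
    rw [sq, ← mul_assoc, hξ]; dsimp only
    rw [Finset.mul_sum]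
    exact Finset.sum_congr rfl fun l _ => by ring
  have hξle : ∀ i, |ξ i| ≤ √(∑ i, x i ^ 2) := by
    intro i
    rw [← hS]
    exact Real.abs_le_sqrt (Finset.single_le_sum (f := fun i => ξ i ^ 2)
      (fun i _ => sq_nonneg _) (Finset.mem_univ i))
  set y : n → ℝ → ℂ := fun i t => ∑ l, (v i l : ℂ) * b t l with hy
  set g : n → ℝ → ℂ := fun i t => ∑ l, (v i l : ℂ) * f t l with hg
  have hscal : ∀ i, ∀ᵐ t ∂(volume.restrict (Set.Icc 0 T)),
      ‖y i t - Real.exp (lam i * t) * (β * ξ i)‖ ≤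
        2 * ((Fintype.card n : ℝ) * η) * T * Real.exp (Lam * T) := by
    intro i
    refine norm_sub_exp_mul_le_of_ae_integral_eq (g := g i) hT
      (eigenvalues_le_of_row_sum_le hB hrow i) hLam0 (by positivity) ?_ ?_ ?_ ?_
    · exact integrable_finsetSum _ fun l _ => (hb l).const_mul _
    · exact integrable_finsetSum _ fun l _ => (hf l).const_mul _
    · filter_upwards [hfη] with t ht
      refine (norm_sum_le _ _).trans ?_
      rw [← nsmul_eq_mul, ← Finset.card_univ]
      refine Finset.sum_le_card_nsmul _ _ _ fun l _ => ?_
      rw [norm_mul, Complex.norm_real, Real.norm_eq_abs]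
      exact (mul_le_mul (hvle i l) (ht l) (norm_nonneg _) zero_le_one).trans_eq (one_mul _)
    · filter_upwards [h, ae_restrict_mem measurableSet_Icc] with t ht htT
      have hint : ∀ l, IntervalIntegrable
          (fun s => (v i l : ℂ) * (∑ j, (B l j : ℂ) * b s j + f s l)) volume 0 t := by
        intro l
        have : IntegrableOn
            (fun s => (v i l : ℂ) * (∑ j, (B l j : ℂ) * b s j + f s l)) (Set.Icc 0 T) :=
          ((integrable_finsetSum _ fun j _ => (hb j).const_mul _).add (hf l)).const_mul _
        refine (this.mono_set ?_).intervalIntegrable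
        rw [Set.uIcc_of_le htT.1]; exact Set.Icc_subset_Icc_right htT.2
      rw [hy]; dsimp only
      simp_rw [ht, mul_add, Finset.sum_add_distrib, ← intervalIntegral.integral_const_mul]
      rw [← intervalIntegral.integral_finsetSum fun l _ => hint l]
      congr 1
      · rw [hξ]; push_cast; rw [Finset.mul_sum]
        exact Finset.sum_congr rfl fun l _ => by ring
      · refine intervalIntegral.integral_congr fun s _ => ?_
        dsimp only
        simp_rw [mul_add, Finset.sum_add_distrib, hg]
        congr 1
        simp_rw [Finset.mul_sum]
        rw [Finset.sum_comm]
        refine Finset.sum_congr rfl fun j _ => ?_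
        have : (∑ l, (v i l : ℂ) * (B l j : ℂ)) = lam i * v i j := by
          have := hBv i j
          rw [show ∑ l, B j l * v i l = ∑ l, v i l * B l j from
            Finset.sum_congr rfl fun l _ => by rw [hBs j l, mul_comm]] at this
          exact_mod_cast this
        rw [← mul_assoc, ← this, Finset.sum_mul]
        exact Finset.sum_congr rfl fun l _ => by ring
  filter_upwards [ae_all_iff.2 hscal, ae_restrict_mem measurableSet_Icc] with t ht htT
  have hsum : ∑ i, (x i : ℂ) * b t i = ∑ i, (ξ i : ℂ) * y i t := by
    simp_rw [hy, Finset.mul_sum]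
    rw [Finset.sum_comm]
    refine Finset.sum_congr rfl fun l _ => ?_
    rw [hxexp l]; push_cast; rw [Finset.sum_mul]
    exact Finset.sum_congr rfl fun i _ => by ring
  -- The initial value is a multiple of `x`, the same vector against which the solution is tested.
  -- The contributions of the eigenvectors are therefore `ξ i ^ 2` times positive exponentials and
  -- cannot cancel.
  have hmain : ∑ i, (ξ i : ℂ) * (Real.exp (lam i * t) * (β * ξ i)) =
      β * ((∑ i, ξ i ^ 2 * Real.exp (lam i * t) : ℝ) : ℂ) := by
    push_cast
    rw [Finset.mul_sum]
    exact Finset.sum_congr rfl fun i _ => by ring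
  have hdiff : ‖∑ i, (ξ i : ℂ) * y i t - β * ((∑ i, ξ i ^ 2 * Real.exp (lam i * t) : ℝ) : ℂ)‖ ≤
      2 * (Fintype.card n : ℝ) ^ 2 * √(∑ i, x i ^ 2) * η * T * Real.exp (Lam * T) := by
    rw [← hmain, ← Finset.sum_sub_distrib]
    refine (norm_sum_le _ _).trans ?_
    calc _ ≤ ∑ _i : n, √(∑ i, x i ^ 2) *
          (2 * ((Fintype.card n : ℝ) * η) * T * Real.exp (Lam * T)) := by
          refine Finset.sum_le_sum fun i _ => ?_
          rw [← mul_sub, norm_mul, Complex.norm_real, Real.norm_eq_abs]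
          exact mul_le_mul (hξle i) (ht i) (norm_nonneg _) (Real.sqrt_nonneg _)
      _ = _ := by rw [Finset.sum_const, Finset.card_univ, nsmul_eq_mul]; ring
  -- Jensen with weights `ξ i ^ 2`, in tangent-line form: `exp (λ t) ≥ exp (mu t) (1 + (λ - mu) t)`.
  -- The linear terms sum to something nonnegative by the Rayleigh quotient hypothesis and `t ≥ 0`.
  have hjensen : (∑ i, x i ^ 2) * Real.exp (mu * t) ≤ ∑ i, ξ i ^ 2 * Real.exp (lam i * t) := by
    have h1 : ∀ i, ξ i ^ 2 * (Real.exp (mu * t) * ((lam i - mu) * t + 1)) ≤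
        ξ i ^ 2 * Real.exp (lam i * t) := by
      intro i
      refine mul_le_mul_of_nonneg_left ?_ (sq_nonneg _)
      calc _ ≤ Real.exp (mu * t) * Real.exp ((lam i - mu) * t) :=
            mul_le_mul_of_nonneg_left (Real.add_one_le_exp _) (Real.exp_pos _).le
        _ = _ := by rw [← Real.exp_add]; congr 1; ring
    refine le_trans ?_ (Finset.sum_le_sum fun i _ => h1 i)
    have h2 : ∑ i, ξ i ^ 2 * (Real.exp (mu * t) * ((lam i - mu) * t + 1)) =
        Real.exp (mu * t) * (t * (∑ i, lam i * ξ i ^ 2 - mu * ∑ i, ξ i ^ 2) + ∑ i, ξ i ^ 2) := by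
      rw [Finset.mul_sum, ← Finset.sum_sub_distrib, Finset.mul_sum, ← Finset.sum_add_distrib,
        Finset.mul_sum]
      exact Finset.sum_congr rfl fun i _ => by ring
    rw [h2, hSlam, hS]
    have h3 : 0 ≤ t * (∑ i, x i * ∑ j, B i j * x j - mu * ∑ i, x i ^ 2) :=
      mul_nonneg htT.1 (sub_nonneg.2 hx)
    have := mul_nonneg (Real.exp_pos (mu * t)).le h3
    linarith
  have hpos : 0 ≤ ∑ i, ξ i ^ 2 * Real.exp (lam i * t) := by positivity
  rw [hsum]
  calc _ ≤ ‖β‖ * ∑ i, ξ i ^ 2 * Real.exp (lam i * t) :=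
        mul_le_mul_of_nonneg_left hjensen (norm_nonneg _)
    _ = ‖β * ((∑ i, ξ i ^ 2 * Real.exp (lam i * t) : ℝ) : ℂ)‖ := by
        rw [norm_mul, Complex.norm_real, Real.norm_eq_abs, abs_of_nonneg hpos]
    _ ≤ _ := by
        refine (norm_le_norm_add_norm_sub _ _).trans (add_le_add_right hdiff _)

/-! ### The symmetrised, truncated chain -/

theorem sum_fin_ite_eq {M : Type*} [AddCommMonoid M] (n k : ℕ) (g : ℕ → M) :
    ∑ j : Fin n, (if (j : ℕ) = k then g j else 0) = if k < n then g k else 0 := by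
  rw [Fin.sum_univ_eq_sum_range (fun j => if j = k then g j else 0) n, Finset.sum_ite_eq']
  simp

theorem sum_fin_ite_eq_succ {M : Type*} [AddCommMonoid M] {n i : ℕ} (hi : i < n) (g : ℕ → M)
    (h0 : g 0 = 0) : ∑ j : Fin n, (if i = (j : ℕ) + 1 then g (j + 1) else 0) = g i := by
  rw [Fin.sum_univ_eq_sum_range (fun j => if i = j + 1 then g (j + 1) else 0) n]
  rcases i with _ | i
  · simp [h0]
  · rw [Finset.sum_eq_single i]
    · simp
    · intro j _ hj; rw [if_neg (by omega)]
    · intro h; exact absurd (Finset.mem_range.2 (by omega)) h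

/-- Symmetrised matrix of the chain `c_l' = -κ (μ_{l-1} c_{l-1} + μ_{l+1} c_{l+1}) - d_l c_l`,
truncated to `1 ≤ l ≤ n`. -/
def chainMatrix (κ : ℝ) (μ d : ℕ → ℝ) (n : ℕ) : Matrix (Fin n) (Fin n) ℝ := fun i j =>
  -κ * (√(μ (i + 1)) * √(μ (j + 1))) *
    ((if (j : ℕ) = i + 1 then 1 else 0) + (if (i : ℕ) = j + 1 then 1 else 0)) -
  (if (j : ℕ) = i then d (i + 1) else 0)

theorem chainMatrix_isHermitian (κ : ℝ) (μ d : ℕ → ℝ) (n : ℕ) :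
    (chainMatrix κ μ d n).IsHermitian := by
  ext i j
  simp only [Matrix.conjTranspose_apply, star_trivial, chainMatrix]
  by_cases h : i = j
  · subst h; rfl
  · have h' : (i : ℕ) ≠ j := fun e => h (Fin.ext e)
    rw [if_neg h', if_neg h'.symm]; ring

/-- Dissipation makes the diagonal nonpositive, and each row has at most two neighbours of size at
most `κ * Mx`. The bound does not depend on `n`, so the truncation can later be removed. -/
theorem chainMatrix_row_sum_le {κ Mx : ℝ} {μ d : ℕ → ℝ} (hκ : 0 ≤ κ)
    (hMx : ∀ l, μ l ≤ Mx) (hMx0 : 0 ≤ Mx) (hd : ∀ l, 0 ≤ d l) (n : ℕ) (i : Fin n) :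
    chainMatrix κ μ d n i i + ∑ j ∈ Finset.univ.erase i, |chainMatrix κ μ d n i j| ≤
      2 * κ * Mx := by
  have hs : ∀ l l', √(μ l) * √(μ l') ≤ Mx := fun l l' =>
    (mul_le_mul (Real.sqrt_le_sqrt (hMx l)) (Real.sqrt_le_sqrt (hMx l')) (Real.sqrt_nonneg _)
      (Real.sqrt_nonneg _)).trans_eq (Real.mul_self_sqrt hMx0)
  have h1 : chainMatrix κ μ d n i i ≤ 0 := by
    simp [chainMatrix, hd]
  have h2 : ∀ j ∈ Finset.univ.erase i, |chainMatrix κ μ d n i j| ≤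
      (if (j : ℕ) = i + 1 then κ * Mx else 0) + (if (i : ℕ) = j + 1 then κ * Mx else 0) := by
    intro j hj
    have hne : (j : ℕ) ≠ i := fun e => (Finset.ne_of_mem_erase hj) (Fin.ext e)
    have hb : |(-κ * (√(μ (i + 1)) * √(μ (j + 1))))| ≤ κ * Mx := by
      rw [abs_mul, abs_neg, abs_of_nonneg hκ, abs_of_nonneg (by positivity)]
      exact mul_le_mul_of_nonneg_left (hs _ _) hκ
    rw [chainMatrix, if_neg hne, sub_zero, abs_mul]
    by_cases h3 : (j : ℕ) = i + 1
    · have h4 : ¬ (i : ℕ) = j + 1 := by omega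
      rw [if_pos h3, if_neg h4, if_pos h3, if_neg h4]
      simpa using hb
    · by_cases h4 : (i : ℕ) = j + 1
      · rw [if_neg h3, if_pos h4, if_neg h3, if_pos h4]
        simpa using hb
      · simp [h3, h4]
  have hκM : 0 ≤ κ * Mx := mul_nonneg hκ hMx0
  have h3 : ∑ j ∈ Finset.univ.erase i, |chainMatrix κ μ d n i j| ≤ κ * Mx + κ * Mx := by
    refine (Finset.sum_le_sum h2).trans ?_
    refine (Finset.sum_le_sum_of_subset_of_nonneg (Finset.subset_univ _)
      fun j _ _ => by positivity).trans ?_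
    rw [Finset.sum_add_distrib]
    refine add_le_add ?_ ?_
    · rw [sum_fin_ite_eq n (i + 1) (fun _ => κ * Mx)]
      split_ifs <;> simp [hκM]
    · have := sum_fin_ite_eq_succ i.2 (fun l => if l = 0 then 0 else κ * Mx) (by simp)
      simp only [Nat.add_eq_zero_iff, one_ne_zero, and_false, if_false] at this
      rw [this]; split_ifs <;> simp [hκM]
  linarith

/-- Passing to `√μ_l c_l` replaces the couplings `μ_{l±1}` by symmetric ones `√μ_l √μ_{l±1}`. Index
`i` stands for `l = i + 1`. The left end closes because `μ 0 = 0`; the `if` drops the link from the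
last mode to its right neighbour. -/
theorem chainMatrix_mulVec {κ : ℝ} {μ d : ℕ → ℝ} (hμ : ∀ l, 0 ≤ μ l) (hμ0 : μ 0 = 0) {n : ℕ}
    (i : Fin n) (c : ℕ → ℂ) :
    ∑ j : Fin n, (chainMatrix κ μ d n i j : ℂ) * (√(μ (j + 1)) * c (j + 1)) =
      √(μ (i + 1)) * (-κ * (μ i * c i + (if (i : ℕ) + 1 < n then μ (i + 2) * c (i + 2) else 0))
        - d (i + 1) * c (i + 1)) := by
  have hsq : ∀ l, (√(μ l) : ℂ) * √(μ l) = μ l := fun l => by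
    exact_mod_cast Real.mul_self_sqrt (hμ l)
  have e : ∀ j : Fin n, (chainMatrix κ μ d n i j : ℂ) * (√(μ (j + 1)) * c (j + 1)) =
      -κ * √(μ (i + 1)) * ((if (j : ℕ) = i + 1 then (fun l : ℕ => (μ (l + 1) : ℂ) * c (l + 1)) j
        else 0) + (if (i : ℕ) = j + 1 then (fun l : ℕ => (μ l : ℂ) * c l) (j + 1) else 0)) -
      (if (j : ℕ) = i then (fun l : ℕ => (d (l + 1) : ℂ) * (√(μ (l + 1)) * c (l + 1))) j
        else 0) := by
    intro j
    dsimp only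
    rw [← hsq (j + 1)]
    clear hsq
    simp only [chainMatrix]
    push_cast
    split_ifs with h1 h2 h3 h4 h5 h6 <;> first | omega | skip
    all_goals (try simp only [*]); push_cast; ring
  rw [Finset.sum_congr rfl fun j _ => e j, Finset.sum_sub_distrib, ← Finset.mul_sum,
    Finset.sum_add_distrib, sum_fin_ite_eq _ _ fun l : ℕ => (μ (l + 1) : ℂ) * c (l + 1),
    sum_fin_ite_eq_succ i.2 (fun l : ℕ => (μ l : ℂ) * c l) (by simp [hμ0]),
    sum_fin_ite_eq _ _ fun l : ℕ => (d (l + 1) : ℂ) * (√(μ (l + 1)) * c (l + 1)), if_pos i.2]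
  ring

/-- Exponential growth of the first two components of a forced infinite chain. -/
theorem chain_growth {κ Mx T Q E mu : ℝ} {μ d : ℕ → ℝ} (hκ : 0 ≤ κ) (hT : 0 ≤ T) (hQ : 0 ≤ Q)
    (hE : 0 ≤ E) (hμ : ∀ l, 0 ≤ μ l) (hμ0 : μ 0 = 0) (hMx : ∀ l, μ l ≤ Mx) (hd : ∀ l, 0 ≤ d l)
    (hmu : mu * (μ 1 + μ 2) ≤ 2 * κ * (μ 1 * μ 2) - d 1 * μ 1 - d 2 * μ 2)
    {c q : ℝ → ℕ → ℂ} {β : ℂ} (r : ℕ)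
    (hc : ∀ l, IntegrableOn (fun t => c t l) (Set.Icc 0 T))
    (hq : ∀ l, IntegrableOn (fun t => q t l) (Set.Icc 0 T))
    (hcE : ∀ᵐ t ∂(volume.restrict (Set.Icc 0 T)), ∀ l, ‖c t l‖ ≤ E)
    (hqQ : ∀ᵐ t ∂(volume.restrict (Set.Icc 0 T)), ∀ l, ‖q t l‖ ≤ Q)
    (h : ∀ᵐ t ∂(volume.restrict (Set.Icc 0 T)), ∀ l : ℕ,
      c t (l + 1) = (if l = 0 then β else if l = 1 then -β else 0) + ∫ s in (0 : ℝ)..t,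
        (-κ * (μ l * c s l + μ (l + 2) * c s (l + 2)) - d (l + 1) * c s (l + 1) + q s (l + 1))) :
    ∀ᵐ t ∂(volume.restrict (Set.Icc 0 T)),
      ‖β‖ * ((μ 1 + μ 2) * Real.exp (mu * t)) ≤ (μ 1 + μ 2) * E +
        2 * ((r : ℝ) + 2) ^ 2 * √(μ 1 + μ 2) * (√Mx * Q + κ * √(μ (r + 2)) * μ (r + 3) * E) * T *
          Real.exp (2 * κ * Mx * T) := by
  have hMx0 : 0 ≤ Mx := (hμ 0).trans (hMx 0)
  have hsq : ∀ l, √(μ l) * √(μ l) = μ l := fun l => Real.mul_self_sqrt (hμ l)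
  have hsle : ∀ l, √(μ l) ≤ √Mx := fun l => Real.sqrt_le_sqrt (hMx l)
  -- The datum `(1, -1, 0, …)` in symmetrised variables. Opposite signs turn the coupling `-κ` into
  -- a positive contribution `2 κ μ_1 μ_2` to the quadratic form. The size `r + 2` always retains
  -- these two modes.
  set x : Fin (r + 2) → ℝ := fun i =>
    √(μ (i + 1)) * (if (i : ℕ) = 0 then 1 else if (i : ℕ) = 1 then -1 else 0) with hx
  have hx2 : ∑ i, x i ^ 2 = μ 1 + μ 2 := by
    rw [Fin.sum_univ_succ, Fin.sum_univ_succ]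
    simp [hx, Real.sq_sqrt (hμ _)]
  have hxB : ∑ i, x i * ∑ j, chainMatrix κ μ d (r + 2) i j * x j =
      2 * κ * (μ 1 * μ 2) - d 1 * μ 1 - d 2 * μ 2 := by
    simp only [Fin.sum_univ_succ]
    simp [hx, chainMatrix]
    linear_combination (κ * (√(μ 2) * √(μ 2)) * 2 - d 1) * hsq 1 + (2 * κ * μ 1 - d 2) * hsq 2
  -- The link cut by the truncation becomes a forcing of the last row, controlled by the a priori
  -- bound `E` on `c`.
  set f : ℝ → Fin (r + 2) → ℂ := fun t i => √(μ (i + 1)) *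
    (q t (i + 1) - (if (i : ℕ) + 1 < r + 2 then 0 else κ * (μ (i + 2) * c t (i + 2)))) with hf
  have main := growth_of_symmetric_system (chainMatrix_isHermitian κ μ d (r + 2)) hT
    (Lam := 2 * κ * Mx) (mu := mu) (η := √Mx * Q + κ * √(μ (r + 2)) * μ (r + 3) * E) (x := x)
    (b := fun t i => √(μ (i + 1)) * c t (i + 1)) (f := f) (β := β)
    (by positivity) (by have := hμ (r + 3); positivity)
    (chainMatrix_row_sum_le hκ hMx hMx0 hd (r + 2)) (by rw [hx2, hxB]; exact hmu)
    (fun i => (hc _).const_mul _) ?_ ?_ ?_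
  · filter_upwards [main, hcE] with t ht htE
    rw [hx2, Fintype.card_fin] at ht
    refine ht.trans ?_
    push_cast
    refine add_le_add_left ?_ _
    have e : ∑ i : Fin (r + 2), (x i : ℂ) * (√(μ (i + 1)) * c t (i + 1)) =
        μ 1 * c t 1 - μ 2 * c t 2 := by
      have h1 : (√(μ 1) : ℂ) * √(μ 1) = μ 1 := by exact_mod_cast hsq 1
      have h2 : (√(μ 2) : ℂ) * √(μ 2) = μ 2 := by exact_mod_cast hsq 2
      rw [Fin.sum_univ_succ, Fin.sum_univ_succ]
      simp [hx]
      linear_combination (c t 1) * h1 - (c t 2) * h2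
    rw [e]
    refine (norm_sub_le _ _).trans ?_
    rw [norm_mul, norm_mul, Complex.norm_real, Complex.norm_real, Real.norm_eq_abs,
      Real.norm_eq_abs, abs_of_nonneg (hμ 1), abs_of_nonneg (hμ 2), add_mul]
    exact add_le_add (mul_le_mul_of_nonneg_left (htE 1) (hμ 1))
      (mul_le_mul_of_nonneg_left (htE 2) (hμ 2))
  · intro i
    refine Integrable.const_mul ((hq _).sub ?_) _
    split_ifs
    · exact integrable_zero _ _ _
    · exact ((hc _).const_mul _).const_mul _
  · filter_upwards [hqQ, hcE] with t htQ htE i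
    rw [hf]; dsimp only
    have hnn : 0 ≤ κ * √(μ (r + 2)) * μ (r + 3) * E :=
      mul_nonneg (mul_nonneg (mul_nonneg hκ (Real.sqrt_nonneg _)) (hμ _)) hE
    rw [mul_sub]
    refine (norm_sub_le _ _).trans (add_le_add ?_ ?_)
    · rw [norm_mul, Complex.norm_real, Real.norm_eq_abs, abs_of_nonneg (Real.sqrt_nonneg _)]
      exact mul_le_mul (hsle _) (htQ _) (norm_nonneg _) (Real.sqrt_nonneg _)
    · split_ifs with hi
      · simpa using hnn
      · have h1 : (i : ℕ) + 1 = r + 2 := by omega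
        have h2 : (i : ℕ) + 2 = r + 3 := by omega
        rw [h1, h2, norm_mul, norm_mul, norm_mul, Complex.norm_real, Complex.norm_real,
          Complex.norm_real, Real.norm_eq_abs, Real.norm_eq_abs, Real.norm_eq_abs,
          abs_of_nonneg hκ, abs_of_nonneg (hμ _), abs_of_nonneg (Real.sqrt_nonneg _)]
        calc √(μ (r + 2)) * (κ * (μ (r + 3) * ‖c t (r + 3)‖))
            = κ * √(μ (r + 2)) * μ (r + 3) * ‖c t (r + 3)‖ := by ring
          _ ≤ _ := mul_le_mul_of_nonneg_left (htE _)
            (mul_nonneg (mul_nonneg hκ (Real.sqrt_nonneg _)) (hμ _))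
  · filter_upwards [h] with t ht i
    rw [ht i, mul_add, ← intervalIntegral.integral_const_mul]
    congr 1
    · simp only [hx]; push_cast; split_ifs <;> push_cast <;> ring
    · refine intervalIntegral.integral_congr fun s _ => ?_
      rw [chainMatrix_mulVec hμ hμ0 i (c s)]
      simp only [hf]
      split_ifs <;> ring

/-! ### The steady state and the linearisation around it -/

/-- The frequency `(0, 0, m)`. -/
def vertVec (m : ℕ) : Freq := ![0, 0, (m : ℤ)]

theorem sinMode_eq_mode (m : ℕ) : sinMode m = mode (-Complex.I) (vertVec m) := by
  funext y
  have : mFourier (vertVec m) y = fourier (m : ℤ) (y 2) := by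
    simp [mFourier, Fin.prod_univ_three, vertVec]
  rw [mode, this, sinMode]
  simp

theorem derivSymbol_single (j : Fin 3) (k : Freq) :
    derivSymbol (Pi.single j 1) k = Complex.I * (k j : ℂ) := by
  rw [derivSymbol, Finset.prod_eq_single j]
  · simp
  · intro i _ hi; simp [Pi.single_eq_of_ne hi]
  · simp

theorem derivSymbol_zero (k : Freq) : derivSymbol 0 k = 1 := by simp [derivSymbol]

theorem coeff_sinMode_eq_zero {m : ℕ} {k : Freq} (h1 : k ≠ vertVec m) (h2 : k ≠ -vertVec m) :
    coeff (sinMode m) k = 0 := by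
  rw [sinMode_eq_mode, coeff_mode, if_neg h1, if_neg h2]; simp

/-- A function of `x₃` alone has `k₁ = k₂ = 0`, where all three numerators vanish: the steady state
carries no velocity. -/
theorem velocitySymbol_mul_coeff_sinMode (N : ℝ) (j : Fin 3) (m : ℕ) (k : Freq) :
    velocitySymbol N j k * coeff (sinMode m) k = 0 := by
  by_cases h : k = vertVec m ∨ k = -vertVec m
  · have h0 : k 0 = 0 := by rcases h with rfl | rfl <;> simp [vertVec]
    have h1 : k 1 = 0 := by rcases h with rfl | rfl <;> simp [vertVec]
    have : velocityNumerator N k j = 0 := by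
      fin_cases j <;> simp [velocityNumerator, h0, h1]
    simp [velocitySymbol, this]
  · rw [not_or] at h
    rw [coeff_sinMode_eq_zero h.1 h.2, mul_zero]

theorem trig_const (z : ℂ) (κ : Freq) :
    trig (fun _ : Unit => z) (fun _ => κ) = mode z κ := by
  funext y; simp [trig]

/-- The partial derivatives of `sin (m x₃)`. -/
def gradSinMode (m : ℕ) (j : Fin 3) : Torus → ℝ :=
  mode (derivSymbol (Pi.single j 1) (vertVec m) * -Complex.I) (vertVec m)

theorem gradSinMode_two (m : ℕ) : gradSinMode m 2 = mode (m : ℂ) (vertVec m) := by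
  have : Complex.I * ((m : ℤ) : ℂ) * -Complex.I = m := by
    push_cast; linear_combination (-(m : ℂ)) * Complex.I_mul_I
  rw [gradSinMode, derivSymbol_single]
  simp only [vertVec, Matrix.cons_val]
  rw [this]

theorem gradSinMode_of_ne (m : ℕ) {j : Fin 3} (hj : j ≠ 2) : gradSinMode m j = 0 := by
  have : vertVec m j = 0 := by fin_cases j <;> simp_all [vertVec]
  funext y
  simp [gradSinMode, derivSymbol_single, this, mode]

theorem isMultiplier_gradSinMode (m : ℕ) (j : Fin 3) :
    IsMultiplier (derivSymbol (Pi.single j 1)) (sinMode m) (gradSinMode m j) := by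
  have h := isMultiplier_trig (ι := Unit) (derivSymbol_neg (Pi.single j 1))
    (fun _ => -Complex.I) (fun _ => vertVec m)
  rw [sinMode_eq_mode]
  rwa [trig_const, trig_const] at h

theorem integrable_sinMode (m : ℕ) : Integrable (sinMode m) torusMeasure := by
  rw [sinMode_eq_mode]; exact integrable_mode _ _

theorem exists_isMultiplier_of_multiplierNorm_lt {σ : Freq → ℂ} {p : ℝ≥0∞} {f : Torus → ℝ}
    {E : ℝ≥0∞} (h : multiplierNorm σ p f < E) :
    ∃ g, IsMultiplier σ f g ∧ eLpNorm g p torusMeasure < E := by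
  obtain ⟨g, hg⟩ := iInf_lt_iff.1 h
  obtain ⟨h1, h2⟩ := iInf_lt_iff.1 hg
  exact ⟨g, h1, h2⟩

/-- Only the `L²` consequence of the `W^{1,4}` bound is used, since Parseval then controls the
velocity. -/
theorem memLp_two_and_integral_sq_le {g : Torus → ℝ} {E : ℝ} (hE : 0 ≤ E)
    (hg : Integrable g torusMeasure) (h : eLpNorm g 4 torusMeasure < ENNReal.ofReal E) :
    MemLp g 2 torusMeasure ∧ ∫ y, g y ^ 2 ∂torusMeasure ≤ E ^ 2 := by
  have h2 : eLpNorm g 2 torusMeasure < ENNReal.ofReal E :=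
    (eLpNorm_le_eLpNorm_of_exponent_le (by norm_num) hg.1).trans_lt h
  have hm : MemLp g 2 torusMeasure := ⟨hg.1, h2.trans ENNReal.ofReal_lt_top⟩
  refine ⟨hm, ?_⟩
  rw [hm.eLpNorm_eq_integral_rpow_norm (by norm_num) (by norm_num)] at h2
  have h3 := (ENNReal.ofReal_le_ofReal_iff hE).1 h2.le
  simp only [ENNReal.toReal_ofNat, Real.rpow_ofNat, Real.norm_eq_abs, sq_abs] at h3
  have h0 : 0 ≤ ∫ y, g y ^ 2 ∂torusMeasure := integral_nonneg fun y => sq_nonneg _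
  have h4 := pow_le_pow_left₀ (Real.rpow_nonneg h0 _) h3 2
  rwa [← Real.rpow_natCast, ← Real.rpow_mul h0, show (2 : ℝ)⁻¹ * ((2 : ℕ) : ℝ) = 1 by norm_num,
    Real.rpow_one] at h4

theorem norm_coeff_sum_mul_le {u g : Fin 3 → Torus → ℝ} {A B : ℝ}
    (hu : ∀ j, MemLp (u j) 2 torusMeasure) (hg : ∀ j, MemLp (g j) 2 torusMeasure)
    (hA : ∀ j, ∫ y, u j y ^ 2 ∂torusMeasure ≤ A) (hB : ∀ j, ∫ y, g j y ^ 2 ∂torusMeasure ≤ B)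
    (k : Freq) : ‖coeff (fun y => ∑ j, u j y * g j y) k‖ ≤ 3 * ((A + B) / 2) := by
  have hu2 : ∀ j, Integrable (fun y => u j y ^ 2) torusMeasure := fun j => (hu j).integrable_sq
  have hg2 : ∀ j, Integrable (fun y => g j y ^ 2) torusMeasure := fun j => (hg j).integrable_sq
  have hug : ∀ j, Integrable (fun y => u j y * g j y) torusMeasure := fun j =>
    (hu j).integrable_mul (hg j)
  rw [coeff_sum _ fun j _ => hug j]
  refine (norm_sum_le _ _).trans ?_
  refine (Finset.sum_le_card_nsmul _ _ ((A + B) / 2) fun j _ => ?_).trans_eq (by simp)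
  refine (norm_coeff_le_integral _ k).trans ?_
  calc _ ≤ ∫ y, (u j y ^ 2 + g j y ^ 2) / 2 ∂torusMeasure := by
        refine integral_mono (hug j).abs (((hu2 j).add (hg2 j)).div_const 2) fun y => ?_
        dsimp only
        rw [abs_mul, ← sq_abs (u j y), ← sq_abs (g j y)]
        nlinarith [sq_nonneg (|u j y| - |g j y|)]
    _ = ((∫ y, u j y ^ 2 ∂torusMeasure) + ∫ y, g j y ^ 2 ∂torusMeasure) / 2 := by
        rw [integral_div, integral_add (hu2 j) (hg2 j)]
    _ ≤ _ := by linarith [hA j, hB j]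

/-- At a fixed time, the nonlinearity is the linearisation at `sin (m x₃)` up to a quadratic
error. -/
theorem nonlinearity_near_sinMode {N E : ℝ} (hN : 0 < N) (hE : 0 ≤ E) {m : ℕ}
    {θ₁ θ : Torus → ℝ} {u G : Fin 3 → Torus → ℝ} (hθ₁ : θ₁ =ᵐ[torusMeasure] sinMode m)
    (hW : W14.norm (θ₁ - θ) < ENNReal.ofReal E)
    (hu : ∀ j, IsMultiplier (velocitySymbol N j) θ (u j))
    (hG : ∀ j, IsMultiplier (derivSymbol (Pi.single j 1)) θ (G j)) :
    (∀ k, ‖coeff (sinMode m) k - coeff θ k‖ ≤ E) ∧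
    ∀ k, ‖coeff (fun y => ∑ j, u j y * G j y) k - (m : ℂ) / 2 *
      (coeff (u 2) (k - vertVec m) + coeff (u 2) (k + vertVec m))‖ ≤ 20 * E ^ 2 := by
  have hθ : Integrable θ torusMeasure := (hu 0).1
  have hθ₁i : Integrable θ₁ torusMeasure := (integrable_sinMode m).congr hθ₁.symm
  have hη : ∀ k, coeff (θ₁ - θ) k = coeff (sinMode m) k - coeff θ k := fun k => by
    rw [← coeff_congr_ae hθ₁ k]; exact coeff_sub hθ₁i hθ k
  have hα : ∀ α ∈ multiIndices 1, multiplierNorm (derivSymbol α) 4 (θ₁ - θ) < ENNReal.ofReal E :=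
    fun α hα => (Finset.single_le_sum (f := fun α => multiplierNorm (derivSymbol α) 4 (θ₁ - θ))
      (fun _ _ => zero_le) hα).trans_lt hW
  have hmem0 : (0 : Fin 3 → ℕ) ∈ multiIndices 1 := by
    simp [multiIndices]
  have hmem : ∀ j : Fin 3, Pi.single j 1 ∈ multiIndices 1 := by decide
  obtain ⟨g₀, hg₀, hg₀E⟩ := exists_isMultiplier_of_multiplierNorm_lt (hα 0 hmem0)
  choose g hg hgE using fun j => exists_isMultiplier_of_multiplierNorm_lt (hα _ (hmem j))
  have hgm : ∀ j, MemLp (g j) 2 torusMeasure := fun j =>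
    (memLp_two_and_integral_sq_le hE (hg j).2.1 (hgE j)).1
  have hgsq : ∀ j, ∫ y, g j y ^ 2 ∂torusMeasure ≤ E ^ 2 := fun j =>
    (memLp_two_and_integral_sq_le hE (hg j).2.1 (hgE j)).2
  refine ⟨fun k => ?_, fun k => ?_⟩
  · have h1 := hg₀.2.2 k
    rw [derivSymbol_zero, one_mul, hη] at h1
    rw [← h1]
    refine (norm_coeff_le_integral g₀ k).trans ?_
    have h2 : eLpNorm g₀ 1 torusMeasure < ENNReal.ofReal E :=
      (eLpNorm_le_eLpNorm_of_exponent_le (by norm_num) hg₀.2.1.1).trans_lt hg₀E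
    rw [eLpNorm_one_eq_lintegral_enorm, ← ofReal_integral_norm_eq_lintegral_enorm hg₀.2.1] at h2
    exact (ENNReal.ofReal_le_ofReal_iff hE).1 h2.le
  -- square integrability of the velocity
  have hsumg : HasSum (fun k => normSq k * ‖coeff (θ₁ - θ) k‖ ^ 2)
      (∑ j, ∫ y, g j y ^ 2 ∂torusMeasure) := by
    have := hasSum_sum (s := Finset.univ) fun j _ => hasSum_sq_norm_coeff (hgm j)
    refine this.congr_fun fun k => ?_
    rw [normSq, Finset.sum_mul]
    refine Finset.sum_congr rfl fun j _ => ?_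
    rw [(hg j).2.2 k, derivSymbol_single, norm_mul, norm_mul, Complex.norm_I, one_mul,
      Complex.norm_intCast, mul_pow, sq_abs]
  have hule : ∀ j k, ‖coeff (u j) k‖ ^ 2 ≤ 4 * (normSq k * ‖coeff (θ₁ - θ) k‖ ^ 2) := by
    intro j k
    -- The whole velocity comes from the perturbation, so it is bounded in `L²` by the gradient of
    -- the perturbation, as the constitutive law has order one.
    have h1 : coeff (u j) k = -(velocitySymbol N j k * coeff (θ₁ - θ) k) := by
      rw [(hu j).2.2 k, hη, mul_sub, velocitySymbol_mul_coeff_sinMode]; ring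
    rw [h1, norm_neg, norm_mul, mul_pow, ← mul_assoc]
    exact mul_le_mul_of_nonneg_right (norm_velocitySymbol_sq_le hN j k) (sq_nonneg _)
  have hum : ∀ j, MemLp (u j) 2 torusMeasure := fun j =>
    memLp_two_of_summable_coeff (hu j).2.1
      (Summable.of_nonneg_of_le (fun _ => sq_nonneg _) (hule j) (hsumg.mul_left 4).summable)
  have husq : ∀ j, ∫ y, u j y ^ 2 ∂torusMeasure ≤ 12 * E ^ 2 := by
    intro j
    refine (hasSum_le (hule j) (hasSum_sq_norm_coeff (hum j)) (hsumg.mul_left 4)).trans ?_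
    rw [Fin.sum_univ_three]
    linarith [hgsq 0, hgsq 1, hgsq 2]
  have hGg : ∀ j, G j =ᵐ[torusMeasure] fun y => gradSinMode m j y - g j y := by
    intro j
    refine ae_eq_of_coeff_eq (hG j).2.1 ((isMultiplier_gradSinMode m j).2.1.sub (hg j).2.1)
      fun k => ?_
    rw [coeff_sub (isMultiplier_gradSinMode m j).2.1 (hg j).2.1, (hG j).2.2,
      (isMultiplier_gradSinMode m j).2.2, (hg j).2.2, hη]
    ring
  -- The linear part is `u₃ ∂₃ sin (m x₃) = m u₃ cos (m x₃)`; the rest is a product of two small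
  -- factors.
  have hprod : (fun y => ∑ j, u j y * G j y) =ᵐ[torusMeasure]
      fun y => u 2 y * mode (m : ℂ) (vertVec m) y - ∑ j, u j y * g j y := by
    filter_upwards [hGg 0, hGg 1, hGg 2] with y h0 h1 h2
    simp only [Fin.sum_univ_three, h0, h1, h2, gradSinMode_two]
    rw [gradSinMode_of_ne m (by decide), gradSinMode_of_ne m (by decide)]
    simp only [Pi.zero_apply]; ring
  have hi1 : Integrable (fun y => u 2 y * mode (m : ℂ) (vertVec m) y) torusMeasure :=
    (hu 2).2.1.mul_bdd (c := ‖(m : ℂ)‖) (continuous_mode _ _).aestronglyMeasurable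
      (.of_forall fun y => abs_mode_le _ _ y)
  have hi2 : Integrable (fun y => ∑ j, u j y * g j y) torusMeasure :=
    integrable_finsetSum _ fun j _ => (hum j).integrable_mul (hgm j)
  rw [coeff_congr_ae hprod, coeff_sub hi1 hi2, coeff_mul_mode (hu 2).2.1]
  have e : ∀ a b c : ℂ, ((m : ℂ) * a + conj (m : ℂ) * b) / 2 - c - m / 2 * (a + b) = -c := by
    intro a b c; rw [Complex.conj_natCast]; ring
  rw [e, norm_neg]
  refine (norm_coeff_sum_mul_le hum hgm husq hgsq k).trans ?_
  -- The constant is `3 (12 + 1) / 2 = 19.5`, rounded up to `20`.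
  nlinarith [sq_nonneg E]

theorem SobolevSpace.norm_sinMode_le (Y : SobolevSpace) (m : ℕ) :
    Y.norm (sinMode m) ≤ ENNReal.ofReal (Y.weight (vertVec m)) := by
  have := Y.norm_trig_le (fun _ : Unit => -Complex.I) (fun _ => vertVec m)
  rw [sinMode_eq_mode]
  rw [trig_const] at this
  simpa using this

/-- `sin (m x₃)` is a steady state. -/
theorem isSolution_sinMode (N ε γ : ℝ) (m : ℕ) (X : SobolevSpace) (T : ℝ) :
    IsSolution N ε γ (source ε γ m) X T (sinMode m) (fun _ => sinMode m) := by
  have hz : ∀ k, coeff (fun _ => (0 : ℝ)) k = 0 := fun k => by simp [coeff_eq]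
  refine ⟨fun k => aemeasurable_const, ⟨(X.weight (vertVec m)).toNNReal, .of_forall fun t => X.norm_sinMode_le m⟩,
    fun _ _ _ => 0, fun _ => gradSinMode m, .of_forall fun t => ⟨fun j => ⟨integrable_sinMode m,
      integrable_zero _ _ _, fun k => ?_⟩, isMultiplier_gradSinMode m, by simp⟩, fun k => ⟨?_, ?_⟩⟩
  · rw [velocitySymbol_mul_coeff_sinMode, hz]
  · simp [hz]
  · refine .of_forall fun t => ?_
    -- At `±(0,0,m)` one has `|k|^{2γ} = m^{2γ}`, so the source exactly balances the diffusion.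
    have hS : coeff (source ε γ m) k = (ε * fracLaplacianSymbol γ k : ℝ) * coeff (sinMode m) k := by
      rw [show source ε γ m = fun y => (ε * (m : ℝ) ^ (2 * γ)) * sinMode m y from rfl,
        coeff_const_mul]
      by_cases h : k = vertVec m ∨ k = -vertVec m
      · have h1 : normSq k = (m : ℝ) ^ 2 := by
          have : normSq (vertVec m) = (m : ℝ) ^ 2 := by
            simp [normSq, vertVec, Fin.sum_univ_three]
          rcases h with rfl | rfl
          · exact this
          · rw [normSq_neg, this]
        rw [fracLaplacianSymbol, h1, ← Real.rpow_natCast, ← Real.rpow_mul (by positivity)]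
        norm_num
      · rw [not_or] at h
        rw [coeff_sinMode_eq_zero h.1 h.2]; simp
    simp [hz, hS]

/-! ### The chain of frequencies and the perturbed solution -/

theorem waveVec_ne_vertVec {j m l m' : ℕ} (hj : 1 ≤ j) :
    waveVec j m l ≠ vertVec m' ∧ waveVec j m l ≠ -vertVec m' := by
  constructor <;> intro h <;> have h1 := congrFun h 1 <;> simp [waveVec, vertVec] at h1 <;> omega

theorem waveVec_eq_iff {j m l l' : ℕ} (hm : 1 ≤ m) : waveVec j m l = waveVec j m l' ↔ l = l' := by
  refine ⟨fun h => ?_, fun h => by rw [h]⟩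
  have h2 := congrFun h 2
  simp only [waveVec, Matrix.cons_val] at h2
  have : m * l = m * l' := by exact_mod_cast h2
  exact Nat.eq_of_mul_eq_mul_left hm this

theorem waveVec_ne_neg {j m l l' : ℕ} (hj : 1 ≤ j) : waveVec j m l ≠ -waveVec j m l' := by
  intro h
  have h1 := congrFun h 1
  simp [waveVec] at h1
  omega

theorem waveVec_sub_vertVec (j m l : ℕ) : waveVec j m (l + 1) - vertVec m = waveVec j m l := by
  ext i; fin_cases i <;> simp [waveVec, vertVec]; ring

theorem waveVec_add_vertVec (j m l : ℕ) :
    waveVec j m (l + 1) + vertVec m = waveVec j m (l + 2) := by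
  ext i; fin_cases i <;> simp [waveVec, vertVec]; ring

/-- The perturbed initial datum `sin (m x₃) + δ (cos (k₁·x) - cos (k₂·x))` with
`k_l = (j², j, m l)`. -/
def perturbedDatum (δ : ℝ) (j m : ℕ) : Torus → ℝ :=
  trig ![-Complex.I, (δ : ℂ), -(δ : ℂ)] ![vertVec m, waveVec j m 1, waveVec j m 2]

/-- A cosine of amplitude `δ` has coefficient `δ / 2`. The conjugate frequencies and `±(0,0,m)` do
not meet the chain, since its second component is `j ≥ 1`. -/
theorem coeff_perturbedDatum (δ : ℝ) {j m : ℕ} (hm : 1 ≤ m) (hj : 1 ≤ j) (l : ℕ) :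
    coeff (perturbedDatum δ j m) (waveVec j m (l + 1)) =
      if l = 0 then (δ / 2 : ℂ) else if l = 1 then -(δ / 2 : ℂ) else 0 := by
  rw [perturbedDatum, coeff_trig, Fin.sum_univ_three]
  simp [(waveVec_ne_vertVec hj).1, (waveVec_ne_vertVec hj).2, waveVec_ne_neg hj,
    waveVec_eq_iff hm]
  rcases l with _ | _ | l <;> simp
  ring

theorem sinMode_sub_perturbedDatum (δ : ℝ) (j m : ℕ) :
    sinMode m - perturbedDatum δ j m =
      trig ![-(δ : ℂ), (δ : ℂ)] ![waveVec j m 1, waveVec j m 2] := by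
  funext y
  simp [perturbedDatum, trig, Fin.sum_univ_three, sinMode_eq_mode, mode]
  ring

theorem zeroVerticalMean_trig {ι : Type*} [Fintype ι] (z : ι → ℂ) {κ : ι → Freq}
    (h : ∀ i, κ i 2 ≠ 0) : ZeroVerticalMean (trig z κ) := by
  intro k hk
  rw [coeff_trig]
  refine Finset.sum_eq_zero fun i _ => ?_
  have h1 : k ≠ κ i := fun e => h i (e ▸ hk)
  have h2 : k ≠ -κ i := fun e => h i (by
    have := congrFun e 2
    rw [hk, Pi.neg_apply] at this
    omega)
  rw [if_neg h1, if_neg h2]; simp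

theorem zeroVerticalMean_sinMode {m : ℕ} (hm : 1 ≤ m) : ZeroVerticalMean (sinMode m) := by
  rw [sinMode_eq_mode, ← trig_const]
  refine zeroVerticalMean_trig _ fun _ => ?_
  simp [vertVec]; omega

theorem zeroVerticalMean_perturbedDatum (δ : ℝ) (j : ℕ) {m : ℕ} (hm : 1 ≤ m) :
    ZeroVerticalMean (perturbedDatum δ j m) := by
  refine zeroVerticalMean_trig _ fun i => ?_
  fin_cases i <;> simp [vertVec, waveVec] <;> omega

/-- Growth of the modes `(j², j, m)` and `(j², j, 2m)` of a solution that stays close to the steady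
state. -/
theorem growth_of_solution {N ε γ T T₀ E δ mu : ℝ} (hN : 0 < N) (hε : 0 < ε) {m j : ℕ}
    (hm : 1 ≤ m) (hj : 1 ≤ j) (hT₀ : 0 ≤ T₀) (hT : T₀ ≤ T) (hE : 0 ≤ E) {X : SobolevSpace}
    {θ₁ θ : ℝ → Torus → ℝ}
    (hθ : IsSolution N ε γ (source ε γ m) X T (perturbedDatum δ j m) θ)
    (hθ₁ : ∀ᵐ t ∂(volume.restrict (Set.Icc 0 T)), θ₁ t =ᵐ[torusMeasure] sinMode m)
    (hW : ∀ᵐ t ∂(volume.restrict (Set.Icc 0 T)), W14.norm (θ₁ t - θ t) < ENNReal.ofReal E)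
    (hmu : mu * (waveSymbol N j m 1 + waveSymbol N j m 2) ≤
      m * (waveSymbol N j m 1 * waveSymbol N j m 2) -
      ε * fracLaplacianSymbol γ (waveVec j m 1) * waveSymbol N j m 1 -
      ε * fracLaplacianSymbol γ (waveVec j m 2) * waveSymbol N j m 2) (r : ℕ) :
    ∀ᵐ t ∂(volume.restrict (Set.Icc 0 T₀)),
      |δ| / 2 * ((waveSymbol N j m 1 + waveSymbol N j m 2) * Real.exp (mu * t)) ≤
        (waveSymbol N j m 1 + waveSymbol N j m 2) * E +
        2 * ((r : ℝ) + 2) ^ 2 * √(waveSymbol N j m 1 + waveSymbol N j m 2) *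
          (√((j : ℝ) ^ 2 / N ^ 2) * (20 * E ^ 2) +
            m / 2 * √(waveSymbol N j m (r + 2)) * waveSymbol N j m (r + 3) * E) * T₀ *
          Real.exp (m * ((j : ℝ) ^ 2 / N ^ 2) * T₀) := by
  obtain ⟨hmeas, -, u, G, huG, heq⟩ := hθ
  have hsub : Set.Icc 0 T₀ ⊆ Set.Icc 0 T := Set.Icc_subset_Icc_right hT
  have hres : ∀ {p : ℝ → Prop}, (∀ᵐ t ∂(volume.restrict (Set.Icc 0 T)), p t) →
      ∀ᵐ t ∂(volume.restrict (Set.Icc 0 T₀)), p t := fun h =>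
    ae_restrict_of_ae_restrict_of_subset hsub h
  set μ : ℕ → ℝ := waveSymbol N j m with hμ
  set d : ℕ → ℝ := fun l => ε * fracLaplacianSymbol γ (waveVec j m l) with hd
  set c : ℝ → ℕ → ℂ := fun t l => coeff (θ t) (waveVec j m l) with hc
  set NL : ℝ → ℕ → ℂ := fun t l =>
    coeff (fun y => ∑ i, u t i y * G t i y) (waveVec j m l) with hNL
  set q : ℝ → ℕ → ℂ := fun t l => match l with
    | 0 => 0
    | l + 1 => (m / 2 : ℝ) * (μ l * c t l + μ (l + 2) * c t (l + 2)) - NL t (l + 1) with hq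
  have hcoeff0 : ∀ l, coeff (sinMode m) (waveVec j m l) = 0 := fun l =>
    coeff_sinMode_eq_zero (waveVec_ne_vertVec hj).1 (waveVec_ne_vertVec hj).2
  have hslice : ∀ᵐ t ∂(volume.restrict (Set.Icc 0 T₀)),
      (∀ l, ‖c t l‖ ≤ E) ∧ ∀ l, ‖q t l‖ ≤ 20 * E ^ 2 := by
    filter_upwards [hres hθ₁, hres hW, hres huG] with t h1 h2 h3
    obtain ⟨h4, h5⟩ := nonlinearity_near_sinMode hN hE h1 h2 h3.1 h3.2.1
    refine ⟨fun l => ?_, fun l => ?_⟩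
    · have := h4 (waveVec j m l)
      rwa [hcoeff0, zero_sub, norm_neg] at this
    · rcases l with _ | l
      · simp only [hq, norm_zero]; positivity
      · have := h5 (waveVec j m (l + 1))
        rw [waveVec_sub_vertVec, waveVec_add_vertVec, (h3.1 2).2.2, (h3.1 2).2.2,
          velocitySymbol_waveVec N hm, velocitySymbol_waveVec N hm, ← norm_neg, neg_sub] at this
        simp only [hq, hNL, hc]
        push_cast
        exact this
  have hcint : ∀ l, IntegrableOn (fun t => c t l) (Set.Icc 0 T₀) := fun l =>
    Integrable.of_bound ((hmeas (waveVec j m l)).mono_measure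
      (Measure.restrict_mono hsub le_rfl)).aestronglyMeasurable E (by
        filter_upwards [hslice] with t ht using ht.1 l)
  have hNLint : ∀ l, IntegrableOn (fun t => NL t l) (Set.Icc 0 T₀) := fun l =>
    (heq (waveVec j m l)).1.mono_set hsub
  have hqint : ∀ l, IntegrableOn (fun t => q t l) (Set.Icc 0 T₀) := by
    intro l
    rcases l with _ | l
    · exact integrable_zero _ _ _
    · exact ((((hcint l).const_mul _).add ((hcint (l + 2)).const_mul _)).const_mul _).sub
        (hNLint (l + 1))
  have hsrc : ∀ l, coeff (source ε γ m) (waveVec j m l) = 0 := fun l => by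
    rw [show source ε γ m = fun y => (ε * (m : ℝ) ^ (2 * γ)) * sinMode m y from rfl,
      coeff_const_mul, hcoeff0, mul_zero]
  -- The coupling `κ = m / 2` reflects that `m cos (m x₃)` has coefficients `m / 2` at `±(0,0,m)`.
  have main := chain_growth (κ := m / 2) (Mx := (j : ℝ) ^ 2 / N ^ 2) (T := T₀) (Q := 20 * E ^ 2)
    (E := E) (mu := mu) (μ := μ) (d := d) (c := c) (q := q) (β := (δ / 2 : ℂ)) (by positivity) hT₀
    (by positivity) hE (waveSymbol_nonneg N j m) (waveSymbol_zero N j m) (waveSymbol_le hN hm hj)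
    (fun l => mul_nonneg hε.le (Real.rpow_nonneg (normSq_nonneg _) _))
    (hmu.trans_eq (by rw [hd]; ring)) r hcint hqint (hslice.mono fun t ht => ht.1)
    (hslice.mono fun t ht => ht.2) ?_
  · have h2 : 2 * ((m : ℝ) / 2) = m := by ring
    have h3 : ‖(δ / 2 : ℂ)‖ = |δ| / 2 := by
      rw [norm_div, Complex.norm_real, Real.norm_eq_abs]; simp
    rwa [h2, h3] at main
  · refine ae_all_iff.2 fun l => ?_
    filter_upwards [hres (heq (waveVec j m (l + 1))).2] with t ht
    rw [← coeff_perturbedDatum δ hm hj l]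
    refine ht.trans ?_
    congr 1
    refine intervalIntegral.integral_congr fun s _ => ?_
    rw [hsrc]
    simp only [hq, hd, hc, hNL]
    push_cast
    ring

/-! ### From the Lipschitz estimate to a bound on exponential growth -/

theorem SobolevSpace.norm_perturbedDatum_le (Y : SobolevSpace) {δ : ℝ} (hδ : 0 ≤ δ) (j m : ℕ) :
    Y.norm (perturbedDatum δ j m) ≤ ENNReal.ofReal (Y.weight (vertVec m) +
      δ * (Y.weight (waveVec j m 1) + Y.weight (waveVec j m 2))) := by
  refine (Y.norm_trig_le _ _).trans_eq ?_
  congr 1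
  simp [Fin.sum_univ_three, abs_of_nonneg hδ]
  ring

theorem SobolevSpace.norm_sub_perturbedDatum_le (Y : SobolevSpace) {δ : ℝ} (hδ : 0 ≤ δ)
    (j m : ℕ) :
    Y.norm (sinMode m - perturbedDatum δ j m) ≤ ENNReal.ofReal
      (δ * (Y.weight (waveVec j m 1) + Y.weight (waveVec j m 2))) := by
  rw [sinMode_sub_perturbedDatum]
  refine (Y.norm_trig_le _ _).trans_eq ?_
  congr 1
  simp [abs_of_nonneg hδ]
  ring

/-- By the decay `μ_l = O(l⁻²)`, the cut link has size `r⁻³`, which beats the factor `(r + 2)²` from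
the dimension of the truncated system. -/
theorem sqrt_waveSymbol_mul_le {N : ℝ} (hN : 0 < N) {j m : ℕ} (hm : 1 ≤ m) (hj : 1 ≤ j) (r : ℕ) :
    ((r : ℝ) + 2) ^ 2 * (√(waveSymbol N j m (r + 2)) * waveSymbol N j m (r + 3)) ≤
      √((j : ℝ) ^ 2 / N ^ 2) * ((j : ℝ) ^ 2 / N ^ 2) / (r + 1) := by
  have h3 := waveSymbol_mul_sq_le hN hm hj (r + 3)
  have h2 := Real.sqrt_le_sqrt (waveSymbol_mul_sq_le hN hm hj (r + 2))
  rw [Real.sqrt_mul (waveSymbol_nonneg _ _ _ _), Real.sqrt_sq (by positivity)] at h2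
  push_cast at h2 h3
  have hr : (0 : ℝ) ≤ r := by positivity
  have hs := Real.sqrt_nonneg (waveSymbol N j m (r + 2))
  have hw := waveSymbol_nonneg N j m (r + 3)
  rw [le_div_iff₀ (by positivity)]
  calc _ = (√(waveSymbol N j m (r + 2)) * (r + 2)) *
        (waveSymbol N j m (r + 3) * (((r : ℝ) + 2) * (r + 1))) := by ring
    _ ≤ (√(waveSymbol N j m (r + 2)) * (r + 2)) *
        (waveSymbol N j m (r + 3) * ((r : ℝ) + 3) ^ 2) := by
        gcongr; nlinarith
    _ ≤ _ := mul_le_mul h2 h3 (by positivity) (by positivity)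

/-- The same comparison for the quadratic error: after division by `δ = (r+1)⁻³`, one factor `δ` is
left to absorb `(r + 2)²`. -/
theorem add_two_sq_mul_inv_cube_le (r : ℕ) :
    ((r : ℝ) + 2) ^ 2 * (1 / ((r : ℝ) + 1) ^ 3) ≤ 4 * (1 / ((r : ℝ) + 1)) := by
  have hr0 : (0 : ℝ) ≤ r := by positivity
  rw [mul_one_div, mul_one_div, div_le_div_iff₀ (by positivity) (by positivity)]
  have : ((r : ℝ) + 2) ^ 2 ≤ 4 * ((r : ℝ) + 1) ^ 2 := by nlinarith
  calc _ ≤ (4 * ((r : ℝ) + 1) ^ 2) * ((r : ℝ) + 1) :=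
        mul_le_mul_of_nonneg_right this (by positivity)
    _ = _ := by ring

/-- The growth estimate for a perturbation of size `δ = (r + 1)⁻³`, divided by `δ`. -/
theorem le_of_growth_estimate {κ e S E Mx M T F s ρ δ : ℝ} (hκ : 0 ≤ κ) (hE : 0 ≤ E) (hT : 0 ≤ T)
    (hF : 0 ≤ F) (hδ : 0 < δ) {r : ℝ} (hδr : (r + 2) ^ 2 * δ ≤ 4 * ρ)
    (hs : (r + 2) ^ 2 * s ≤ M * ρ)
    (h : δ / 2 * (S * e) ≤ S * (δ * E) + 2 * (r + 2) ^ 2 * √S *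
      (√Mx * (20 * (δ * E) ^ 2) + κ * s * (δ * E)) * T * F) :
    e / 2 * S ≤ S * E + (2 * √S * (√Mx * (80 * E ^ 2) + κ * M * E) * T * F) * ρ := by
  have h1 : δ * (e / 2 * S) ≤ δ * (S * E + 2 * √S * (T * F) *
      (√Mx * (20 * E ^ 2) * ((r + 2) ^ 2 * δ) + κ * E * ((r + 2) ^ 2 * s))) := by
    linarith
  refine (le_of_mul_le_mul_left h1 hδ).trans ?_
  have h2 : √Mx * (20 * E ^ 2) * ((r + 2) ^ 2 * δ) + κ * E * ((r + 2) ^ 2 * s) ≤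
      √Mx * (20 * E ^ 2) * (4 * ρ) + κ * E * (M * ρ) :=
    add_le_add (mul_le_mul_of_nonneg_left hδr (by positivity))
      (mul_le_mul_of_nonneg_left hs (by positivity))
  have h3 := mul_le_mul_of_nonneg_left h2 (show 0 ≤ 2 * √S * (T * F) by positivity)
  linarith

/-- A Lipschitz estimate near the steady state bounds the growth of the linearised problem by the
size of the initial perturbation. -/
theorem exists_exp_le_of_wellPosed {γ N ε : ℝ} (hN : 0 < N) (hε : 0 < ε) {m : ℕ} (hm : 1 ≤ m)
    {X Y : SobolevSpace} (hX : X.Embeds W14)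
    (h : LocallyLipschitzWellPosed N ε γ (source ε γ m) X Y) :
    ∃ T₀ C : ℝ, 0 < T₀ ∧ 0 < C ∧ ∀ j : ℕ, 1 ≤ j → ∀ mu : ℝ, 0 ≤ mu →
      mu * (waveSymbol N j m 1 + waveSymbol N j m 2) ≤
        m * (waveSymbol N j m 1 * waveSymbol N j m 2) -
        ε * fracLaplacianSymbol γ (waveVec j m 1) * waveSymbol N j m 1 -
        ε * fracLaplacianSymbol γ (waveVec j m 2) * waveSymbol N j m 2 →
      0 < waveSymbol N j m 1 + waveSymbol N j m 2 →
      Real.exp (mu * T₀) ≤ C * (Y.weight (waveVec j m 1) + Y.weight (waveVec j m 2) + 1) := by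
  obtain ⟨T, K, hTc, hKc, hT, hK, hwp⟩ := h
  obtain ⟨CX, hCX⟩ := hX
  set w := Y.weight (vertVec m) with hw
  have hw0 : 0 ≤ w := Y.weight_nonneg _
  -- All data used have `Y`-norm at most `w + 1`. Extremal values of `T` and `K` on this compact
  -- square give a lifespan and a Lipschitz constant independent of `j` and `δ`.
  set B : Set (ℝ≥0 × ℝ≥0) := Set.Icc 0 ((w + 1).toNNReal, (w + 1).toNNReal) with hB
  have hBc : IsCompact B := isCompact_Icc
  have hBn : B.Nonempty := ⟨0, by simp [hB]⟩
  obtain ⟨p, hpB, hp⟩ := hBc.exists_isMinOn hBn hTc.continuousOn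
  obtain ⟨p', hpB', hp'⟩ := hBc.exists_isMaxOn hBn hKc.continuousOn
  set T₀ := T p with hT₀
  set K₀ := K p' with hK₀
  have hT₀pos : 0 < T₀ := hT p
  have hK₀pos : 0 < K₀ := hK p'
  refine ⟨T₀ / 2, 2 * (CX * K₀ + 1), half_pos hT₀pos, by positivity,
    fun j hj mu hmu0 hmu hpos => ?_⟩
  set P := Y.weight (waveVec j m 1) + Y.weight (waveVec j m 2) with hP
  have hP0 : 0 ≤ P := add_nonneg (Y.weight_nonneg _) (Y.weight_nonneg _)
  set S := waveSymbol N j m 1 + waveSymbol N j m 2 with hS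
  -- The Lipschitz estimate gives `δ CX K₀ P`; the added ones make the inequality strict and `E'`
  -- positive even if `P = 0`.
  set E' := (CX * K₀ + 1) * (P + 1) with hE'
  have hE'0 : 0 < E' := by positivity
  set Mx := (j : ℝ) ^ 2 / N ^ 2 with hMx
  have hMx0 : 0 ≤ Mx := by positivity
  -- the estimate for a perturbation of size `(r + 1)⁻³`
  have key : ∀ r : ℕ, P ≤ r → Real.exp (mu * (T₀ / 2)) / 2 * S ≤ S * E' +
      (2 * √S * (√Mx * (80 * E' ^ 2) + m / 2 * (√Mx * Mx) * E') * T₀ * Real.exp (m * Mx * T₀)) *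
        (1 / ((r : ℝ) + 1)) := by
    intro r hr
    have hr0 : (0 : ℝ) ≤ r := by positivity
    set δ : ℝ := 1 / ((r : ℝ) + 1) ^ 3 with hδ
    have hδ0 : 0 < δ := by positivity
    have hδP : δ * P ≤ 1 := by
      rw [hδ, div_mul_eq_mul_div, div_le_one (by positivity), one_mul]
      calc P ≤ (r : ℝ) + 1 := by linarith
        _ ≤ ((r : ℝ) + 1) ^ 3 := le_self_pow₀ (by linarith) (by norm_num)
    have hna : Y.norm (sinMode m) ≤ ENNReal.ofReal (w + 1) :=
      (Y.norm_sinMode_le m).trans (ENNReal.ofReal_le_ofReal (by linarith))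
    have hnb : Y.norm (perturbedDatum δ j m) ≤ ENNReal.ofReal (w + 1) :=
      (Y.norm_perturbedDatum_le hδ0.le j m).trans (ENNReal.ofReal_le_ofReal (by linarith))
    have hnn : ∀ {f : Torus → ℝ}, Y.norm f ≤ ENNReal.ofReal (w + 1) →
        (Y.norm f).toNNReal ≤ (w + 1).toNNReal := fun hf =>
      ENNReal.toNNReal_mono ENNReal.ofReal_ne_top hf
    obtain ⟨θ₁, θ₂, hθ₁, hθ₂, hLip⟩ := hwp (sinMode m) (perturbedDatum δ j m)
      (hna.trans_lt ENNReal.ofReal_lt_top) (hnb.trans_lt ENNReal.ofReal_lt_top)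
      (zeroVerticalMean_sinMode hm) (zeroVerticalMean_perturbedDatum δ j hm)
    set ρ := ((Y.norm (sinMode m)).toNNReal, (Y.norm (perturbedDatum δ j m)).toNNReal) with hρ
    have hρB : ρ ∈ B := ⟨⟨zero_le, zero_le⟩, ⟨hnn hna, hnn hnb⟩⟩
    have hTρ : T₀ ≤ T ρ := hp hρB
    have hKρ : K ρ ≤ K₀ := hp' hρB
    -- Uniqueness identifies the solution provided by well-posedness with the steady state.
    have hsteady : ∀ᵐ t ∂(volume.restrict (Set.Icc 0 (T ρ))),
        θ₁ t =ᵐ[torusMeasure] sinMode m := by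
      filter_upwards [hθ₁.2 _ (isSolution_sinMode N ε γ m X (T ρ))] with t ht using ht.symm
    have hW : ∀ᵐ t ∂(volume.restrict (Set.Icc 0 (T ρ))),
        W14.norm (θ₁ t - θ₂ t) < ENNReal.ofReal (δ * E') := by
      filter_upwards [hLip] with t ht
      calc W14.norm (θ₁ t - θ₂ t) ≤ CX * X.norm (θ₁ t - θ₂ t) := hCX _
        _ ≤ CX * (ENNReal.ofReal K₀ * ENNReal.ofReal (δ * P)) := by
            gcongr
            exact ht.trans (mul_le_mul' (ENNReal.ofReal_le_ofReal hKρ)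
              (Y.norm_sub_perturbedDatum_le hδ0.le j m))
        _ = ENNReal.ofReal (CX * (K₀ * (δ * P))) := by
            rw [ENNReal.ofReal_mul CX.coe_nonneg, ENNReal.ofReal_mul hK₀pos.le,
              ENNReal.ofReal_coe_nnreal]
        _ < ENNReal.ofReal (δ * E') := by
            refine (ENNReal.ofReal_lt_ofReal_iff (by positivity)).2 ?_
            have h1 : 0 ≤ (CX : ℝ) * K₀ := by positivity
            have h2 : (CX : ℝ) * (K₀ * (δ * P)) = δ * (CX * K₀ * P) := by ring
            rw [h2]
            refine mul_lt_mul_of_pos_left ?_ hδ0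
            have h3 : E' = CX * K₀ * P + (CX * K₀ + P + 1) := by rw [hE']; ring
            linarith
    have hgrow := growth_of_solution hN hε hm hj hT₀pos.le hTρ (by positivity : 0 ≤ δ * E')
      hθ₂.1 hsteady hW hmu r
    -- The growth estimate holds only at almost every time, so a good time is picked in `[T₀/2,
    -- T₀]`, a set of positive measure.
    obtain ⟨t, ht, htT⟩ : ∃ t ∈ Set.Icc (T₀ / 2) T₀, _ := by
      have h1 : ∀ᵐ t ∂(volume.restrict (Set.Icc (T₀ / 2) T₀)), _ :=
        ae_restrict_of_ae_restrict_of_subset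
          (Set.Icc_subset_Icc_left (by linarith)) hgrow
      have h2 := h1.and (ae_restrict_mem measurableSet_Icc)
      have : (ae (volume.restrict (Set.Icc (T₀ / 2) T₀))).NeBot := by
        rw [ae_neBot, Ne, Measure.restrict_eq_zero, Real.volume_Icc, ENNReal.ofReal_eq_zero]
        linarith
      obtain ⟨t, ht1, ht2⟩ := h2.exists
      exact ⟨t, ht2, ht1⟩
    rw [abs_of_pos hδ0] at htT
    have hexp : Real.exp (mu * (T₀ / 2)) ≤ Real.exp (mu * t) :=
      Real.exp_le_exp.2 (mul_le_mul_of_nonneg_left ht.1 hmu0)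
    refine le_of_growth_estimate (by positivity) hE'0.le hT₀pos.le (Real.exp_pos _).le hδ0
      (add_two_sq_mul_inv_cube_le r)
      ((sqrt_waveSymbol_mul_le hN hm hj r).trans_eq (by rw [mul_one_div])) ?_
    rw [← mul_assoc (m / 2 : ℝ)]
    exact (mul_le_mul_of_nonneg_left (mul_le_mul_of_nonneg_left hexp hpos.le)
      (half_pos hδ0).le).trans htT
  -- Here `j` is fixed: the error constant is exponentially large in `j²`, but the factor `1 / (r +
  -- 1)` removes it as `r → ∞`.
  have hlim := le_of_tendsto_of_tendsto (tendsto_const_nhds (x := Real.exp (mu * (T₀ / 2)) / 2 * S)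
      (f := atTop)) ((tendsto_one_div_add_atTop_nhds_zero_nat.const_mul
        (2 * √S * (√Mx * (80 * E' ^ 2) + m / 2 * (√Mx * Mx) * E') * T₀ *
          Real.exp (m * Mx * T₀))).const_add (S * E'))
    (by filter_upwards [eventually_ge_atTop ⌈P⌉₊] with r hr using key r (Nat.ceil_le.1 hr))
  rw [mul_zero, add_zero, mul_comm S E'] at hlim
  have := le_of_mul_le_mul_right hlim hpos
  rw [hE'] at this
  linarith

/-! ### The growth rate and the contradiction -/

/-- The growth rate of the linearised problem on the frequencies `(j², j, m l)` is at least of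
order `j²`. -/
theorem exists_growth_rate {γ N ε : ℝ} (hγ₀ : 0 < γ) (hγ₁ : γ < 1 / 2) (hN : 0 < N) (hε : 0 < ε)
    {m : ℕ} (hm : 1 ≤ m) :
    ∃ c : ℝ, 0 < c ∧ ∀ᶠ j : ℕ in atTop,
      (c * j) * (waveSymbol N j m 1 + waveSymbol N j m 2) ≤
        m * (waveSymbol N j m 1 * waveSymbol N j m 2) -
        ε * fracLaplacianSymbol γ (waveVec j m 1) * waveSymbol N j m 1 -
        ε * fracLaplacianSymbol γ (waveVec j m 2) * waveSymbol N j m 2 ∧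
      0 < waveSymbol N j m 1 + waveSymbol N j m 2 := by
  have hm' : (1 : ℝ) ≤ m := by exact_mod_cast hm
  set c₀ := N ^ 2 / (12 * N ^ 4 * (m : ℝ) ^ 2 + 1) with hc₀
  have hc₀pos : 0 < c₀ := by positivity
  refine ⟨c₀ / 4, by positivity, ?_⟩
  -- The diffusion relative to `j²` is `O(j^{4γ-2})`, which tends to zero because `γ < 1/2`.
  have hlim : Tendsto (fun j : ℕ => ε * 3 ^ γ * (j : ℝ) ^ (-(2 - 4 * γ))) atTop
      (𝓝 (ε * 3 ^ γ * 0)) :=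
    ((tendsto_rpow_neg_atTop (by linarith)).comp tendsto_natCast_atTop_atTop).const_mul _
  rw [mul_zero] at hlim
  filter_upwards [hlim.eventually_lt_const (show 0 < c₀ / 4 by positivity),
    eventually_ge_atTop (2 * m)] with j hj hjm
  have hj1 : (1 : ℝ) ≤ j := by exact_mod_cast (by omega : 1 ≤ j)
  have hj0 : (0 : ℝ) < j := by linarith
  have hd : ∀ l ≤ 2, ε * fracLaplacianSymbol γ (waveVec j m l) ≤ c₀ / 4 * (j : ℝ) ^ 2 := by
    intro l hl
    calc ε * fracLaplacianSymbol γ (waveVec j m l) ≤ ε * (3 * (j : ℝ) ^ 4) ^ γ := by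
          refine mul_le_mul_of_nonneg_left ?_ hε.le
          exact Real.rpow_le_rpow (normSq_nonneg _) (normSq_waveVec_le hm hjm hl) hγ₀.le
      _ = ε * 3 ^ γ * (j : ℝ) ^ (-(2 - 4 * γ)) * (j : ℝ) ^ 2 := by
          rw [Real.mul_rpow (by norm_num) (by positivity), ← Real.rpow_natCast _ 4,
            ← Real.rpow_mul hj0.le, mul_assoc (ε * 3 ^ γ), ← Real.rpow_natCast _ 2,
            ← Real.rpow_add hj0, mul_assoc]
          congr 3; push_cast; ring
      _ ≤ _ := mul_le_mul_of_nonneg_right hj.le (by positivity)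
  have h1 := le_waveSymbol (N := N) hm hjm le_rfl (by norm_num : 1 ≤ 2)
  have h2 := le_waveSymbol (N := N) hm hjm (by norm_num : 1 ≤ 2) le_rfl
  rw [← hc₀] at h1 h2
  have hL : 0 < c₀ * (j : ℝ) ^ 2 := by positivity
  set a := waveSymbol N j m 1
  set b := waveSymbol N j m 2
  have ha : 0 < a := hL.trans_le h1
  have hb : 0 < b := hL.trans_le h2
  refine ⟨?_, by positivity⟩
  have hda := mul_le_mul_of_nonneg_right (hd 1 (by norm_num)) ha.le
  have hdb := mul_le_mul_of_nonneg_right (hd 2 le_rfl) hb.le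
  -- Averaging the next two bounds gives `a b ≥ (c₀/2) j² (a + b)`. Diffusion costs at most half of
  -- this, and the remaining rate `(c₀/4) j²` is weakened to `(c₀/4) j`, still enough to beat every
  -- polynomial after exponentiation.
  have hab1 := mul_le_mul_of_nonneg_right h1 hb.le
  have hab2 := mul_le_mul_of_nonneg_right h2 ha.le
  have hab : a * b ≤ m * (a * b) := le_mul_of_one_le_left (by positivity) hm'
  have hjj : c₀ / 4 * (j : ℝ) * (a + b) ≤ c₀ / 4 * (j : ℝ) ^ 2 * (a + b) := by
    gcongr; nlinarith
  nlinarith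

end MG

end

theorem theorem4p5 (γ : ℝ) (hγ₀ : 0 < γ) (hγ₁ : γ < 1 / 2) (N : ℝ) (hN : 0 < N)
    (ε : ℝ) (hε : 0 < ε) (m : ℕ) (hm : 1 ≤ m) (X Y : MG.SobolevSpace)
    (hYX : Y.Embeds X) (hX : X.Embeds MG.W14) :
    ¬ MG.LocallyLipschitzWellPosed N ε γ (MG.source ε γ m) X Y := by
  intro h
  obtain ⟨T, C, hT, hC, hexp⟩ := MG.exists_exp_le_of_wellPosed hN hε hm hX h
  obtain ⟨c, hc, hrate⟩ := MG.exists_growth_rate hγ₀ hγ₁ hN hε hm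
  obtain ⟨A, n, hA, hweight⟩ := Y.exists_weight_le
  set D := C * (2 * (A * 4 ^ n) + 1) with hD
  have hD0 : 0 < D := by positivity
  -- The constant `1 / (2 * D)` makes the polynomial bound at most half of the exponential it is
  -- supposed to dominate.
  have hlo := ((isLittleO_pow_exp_pos_mul_atTop (4 * n) (mul_pos hc hT)).comp_tendsto
    tendsto_natCast_atTop_atTop).bound (show 0 < 1 / (2 * D) by positivity)
  obtain ⟨j, ⟨hj1, hpos⟩, hj2, hjm⟩ :=
    (hrate.and (hlo.and (Filter.eventually_ge_atTop (2 * m)))).exists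
  have hj : (1 : ℝ) ≤ j := by exact_mod_cast (by omega : 1 ≤ j)
  have h1 := hexp j (by omega) (c * j) (by positivity) hj1 hpos
  have hw : ∀ l ≤ 2, Y.weight (MG.waveVec j m l) ≤ A * 4 ^ n * (j : ℝ) ^ (4 * n) := by
    intro l hl
    refine (hweight _).trans ?_
    rw [pow_mul, mul_assoc, ← mul_pow]
    refine mul_le_mul_of_nonneg_left (pow_le_pow_left₀ ?_ ?_ n) hA
    · linarith [MG.normSq_nonneg (MG.waveVec j m l)]
    · linarith [MG.normSq_waveVec_le hm hjm hl, one_le_pow₀ hj (n := 4)]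
  have h2 : Real.exp (c * j * T) ≤ D * (j : ℝ) ^ (4 * n) := by
    refine h1.trans ?_
    rw [hD, mul_assoc]
    refine mul_le_mul_of_nonneg_left ?_ hC.le
    linarith [hw 1 (by norm_num), hw 2 le_rfl, one_le_pow₀ hj (n := 4 * n)]
  simp only [Function.comp_apply, Real.norm_eq_abs, Real.abs_exp] at hj2
  rw [abs_of_nonneg (by positivity), show c * T * (j : ℝ) = c * j * T by ring] at hj2
  have h3 : D * (j : ℝ) ^ (4 * n) ≤ Real.exp (c * j * T) / 2 := by
    refine (mul_le_mul_of_nonneg_left hj2 hD0.le).trans_eq ?_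
    field_simp
  linarith [Real.exp_pos (c * j * T)]
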